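/- Notation. For $b>0$ and an entire function $f:\mathbb C\to\mathbb C$ put $\|f\|_b=\sup_{k\ge 0} b^{-k}|f^{(k)}(0)|$. For $a\ge 0$ let $\mathcal A_a$ be the space of all entire $f$ with $\|f\|_b<\infty$ for every $b>a$, equipped with the topology defined by the family of norms $\|\cdot\|_b$, $b>a$. Let $\mathcal L^+$ (the Laguerre entire functions) be the set of all entire functions of the form $$f(z)=C z^m e^{\alpha z}\prod_{j=1}^\infty(1+\beta_j z),\qquad C\in\mathbb C,\ m\in\mathbb N_0,\ \alpha\ge 0,\ \beta_j\ge\beta_{j+1}\ge 0,\ \sum_{j}\beta_j<\infty,$$ and let $\mathcal L^+_a=\mathcal L^+\cap\mathcal A_a$ carry the topology induced from $\mathcal A_a$. With $D=d/dz$ let $$\Delta_{\theta,\omega}=(\theta+zD)D+\omega zD,\qquad (\varphi(\Delta_{\theta,\omega})f)(z)=\sum_{k=0}^\infty\frac{\varphi^{(k)}(0)}{k!}\,(\Delta_{\theta,\omega}^k f)(z).$$ The expression $\omega^{-1}(e^{a\omega}-1)$ is understood as its limit $a$ when $\omega=0$. Theorem. Let $\theta\ge 0$, $\omega\ge 0$,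 $a\ge 0$, $b\ge 0$ satisfy $b\,\omega^{-1}(e^{a\omega}-1)<1$, and put $$c=b\,e^{a\omega}\bigl(1-b\,\omega^{-1}(e^{a\omega}-1)\bigr)^{-1}.$$ Then for all $\varphi\in\mathcal L^+_a$ and $f\in\mathcal L^+_b$ the series defining $(\varphi(\Delta_{\theta,\omega})f)(z)$ converges absolutely for every $z\in\mathbb C$, its sum $\varphi(\Delta_{\theta,\omega})f$ belongs to $\mathcal L^+_c$, and $(\varphi,f)\mapsto\varphi(\Delta_{\theta,\omega})f$ is a continuous map from $\mathcal L^+_a\times\mathcal L^+_b$ into $\mathcal L^+_c$. -/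

import Mathlib

noncomputable section

/-- The differential expression `Δ_{θ,ω} = (θ + z D) D + ω z D`. -/
def lagDelta (θ ω : ℝ) (f : ℂ → ℂ) : ℂ → ℂ :=
  fun z => (θ : ℂ) * deriv f z + z * deriv (deriv f) z + (ω : ℂ) * z * deriv f z

/-- The norm `‖f‖_b = sup_k b^{-k} |f^{(k)}(0)|`; it is only used for functions for which the
supremum is finite. -/
def expNorm (b : ℝ) (f : ℂ → ℂ) : ℝ :=
  ⨆ k : ℕ, (b ^ k)⁻¹ * ‖iteratedDeriv k f 0‖

/-- The assertion `‖f‖_b < ∞`. -/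
def ExpNormFinite (b : ℝ) (f : ℂ → ℂ) : Prop :=
  BddAbove (Set.range fun k : ℕ => (b ^ k)⁻¹ * ‖iteratedDeriv k f 0‖)

theorem iteratedDeriv_add_of_entire {f g : ℂ → ℂ} (hf : Differentiable ℂ f)
    (hg : Differentiable ℂ g) (k : ℕ) :
    iteratedDeriv k (f + g) 0 = iteratedDeriv k f 0 + iteratedDeriv k g 0 :=
  iteratedDeriv_add hf.contDiff.contDiffAt hg.contDiff.contDiffAt

theorem iteratedDeriv_smul_at_zero (f : ℂ → ℂ) (c : ℂ) (k : ℕ) :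
    iteratedDeriv k (c • f) 0 = c * iteratedDeriv k f 0 := by
  rw [iteratedDeriv_const_smul_field, smul_eq_mul]

theorem expNormFinite_add {b : ℝ} (hb : 0 < b) {f g : ℂ → ℂ} (hf : Differentiable ℂ f)
    (hg : Differentiable ℂ g) (hf' : ExpNormFinite b f) (hg' : ExpNormFinite b g) :
    ExpNormFinite b (f + g) := by
  obtain ⟨M, hM⟩ := hf'
  obtain ⟨N, hN⟩ := hg'
  refine ⟨M + N, ?_⟩
  rintro _ ⟨k, rfl⟩
  have h1 := hM ⟨k, rfl⟩
  have h2 := hN ⟨k, rfl⟩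
  have h3 : (b ^ k)⁻¹ * ‖iteratedDeriv k (f + g) 0‖ ≤
      (b ^ k)⁻¹ * (‖iteratedDeriv k f 0‖ + ‖iteratedDeriv k g 0‖) := by
    rw [iteratedDeriv_add_of_entire hf hg]
    gcongr
    exact norm_add_le _ _
  simp only at h1 h2 ⊢
  linarith

theorem expNormFinite_smul {b : ℝ} {f : ℂ → ℂ} (hf' : ExpNormFinite b f) (c : ℂ) : ExpNormFinite b (c • f) := by
  obtain ⟨M, hM⟩ := hf'
  refine ⟨‖c‖ * M, ?_⟩
  rintro _ ⟨k, rfl⟩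
  have h1 := mul_le_mul_of_nonneg_left (hM ⟨k, rfl⟩) (norm_nonneg c)
  simp only [iteratedDeriv_smul_at_zero, norm_mul] at h1 ⊢
  linarith

/-- The entire functions `f` with `‖f‖_b < ∞` for all `b > a`, as a vector space. (For `a ≥ 0` the
condition `0 < b` is implied by `a < b`.) -/
def expTypeSubmodule (a : ℝ) : Submodule ℂ (ℂ → ℂ) where
  carrier := {f | Differentiable ℂ f ∧ ∀ b : ℝ, 0 < b → a < b → ExpNormFinite b f}
  add_mem' := fun hf hg =>
    ⟨hf.1.add hg.1, fun b hb hab => expNormFinite_add hb hf.1 hg.1 (hf.2 b hb hab) (hg.2 b hb hab)⟩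
  zero_mem' := by
    refine ⟨differentiable_const 0, fun b _ _ => ⟨0, ?_⟩⟩
    rintro _ ⟨k, rfl⟩
    simp
  smul_mem' := fun c _ hf =>
    ⟨hf.1.const_smul c, fun b hb hab => expNormFinite_smul (hf.2 b hb hab) c⟩

/-- The space `𝒜_a`, a type of its own so that it does not inherit the topology of pointwise
convergence from `ℂ → ℂ`. -/
def ExpType (a : ℝ) : Type := expTypeSubmodule a

instance (a : ℝ) : AddCommGroup (ExpType a) := inferInstanceAs (AddCommGroup (expTypeSubmodule a))

instance (a : ℝ) : Module ℂ (ExpType a) := inferInstanceAs (Module ℂ (expTypeSubmodule a))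

instance (a : ℝ) : CoeFun (ExpType a) (fun _ => ℂ → ℂ) := ⟨fun f => f.1⟩

/-- The norm `‖·‖_b` on `𝒜_a`, for `b > a`. -/
def expSeminorm (a : ℝ) (b : {b : ℝ // 0 < b ∧ a < b}) : Seminorm ℂ (ExpType a) :=
  Seminorm.of (fun f => expNorm b f)
    (by
      intro f g
      have hf := f.2.2 b b.2.1 b.2.2
      have hg := g.2.2 b b.2.1 b.2.2
      refine ciSup_le fun k => ?_
      have h1 := le_ciSup hf k
      have h2 := le_ciSup hg k
      have hb : (0 : ℝ) < b := b.2.1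
      have h3 : ((b : ℝ) ^ k)⁻¹ * ‖iteratedDeriv k (f.1 + g.1) 0‖ ≤
          ((b : ℝ) ^ k)⁻¹ * (‖iteratedDeriv k f.1 0‖ + ‖iteratedDeriv k g.1 0‖) := by
        rw [iteratedDeriv_add_of_entire f.2.1 g.2.1]
        gcongr
        exact norm_add_le _ _
      change ((b : ℝ) ^ k)⁻¹ * ‖iteratedDeriv k (f.1 + g.1) 0‖ ≤ expNorm b f.1 + expNorm b g.1
      simp only [expNorm]
      linarith)
    (by
      intro c f
      change expNorm b (c • f.1) = ‖c‖ * expNorm b f.1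
      simp only [expNorm]
      rw [Real.mul_iSup_of_nonneg (norm_nonneg c)]
      congr 1
      funext k
      rw [iteratedDeriv_smul_at_zero, norm_mul]
      ring)

instance (a : ℝ) : Nonempty {b : ℝ // 0 < b ∧ a < b} :=
  ⟨⟨max a 0 + 1, by have := le_max_right a 0; linarith, by have := le_max_left a 0; linarith⟩⟩

/-- The topology `𝒯_a` defined by the norms `‖·‖_b`, `b > a`. -/
instance (a : ℝ) : TopologicalSpace (ExpType a) :=
  (SeminormFamily.moduleFilterBasis (𝕜 := ℂ) (expSeminorm a)).topology

theorem expType_withSeminorms (a : ℝ) : WithSeminorms (𝕜 := ℂ) (expSeminorm a) := ⟨rfl⟩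

/-- Laguerre entire functions: `f(z) = C z^m e^{α z} ∏_j (1 + β_j z)` with `C ∈ ℂ`, `m ∈ ℕ₀`,
`α ≥ 0`, `β_j ≥ β_{j+1} ≥ 0` and `∑ β_j < ∞`. -/
def IsLaguerreEntire (f : ℂ → ℂ) : Prop :=
  ∃ (C : ℂ) (m : ℕ) (α : ℝ) (β : ℕ → ℝ), 0 ≤ α ∧ Antitone β ∧ (∀ j, 0 ≤ β j) ∧ Summable β ∧
    ∀ z : ℂ, f z = C * z ^ m * Complex.exp (α * z) * ∏' j, (1 + (β j : ℂ) * z)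

/-- The set `ℒ⁺_a = ℒ⁺ ∩ 𝒜_a`, a subset of the topological space `𝒜_a`. -/
def laguerrePlus (a : ℝ) : Set (ExpType a) := {f | IsLaguerreEntire f}

/-- `ω⁻¹ (e^{aω} - 1)`, understood as its limit `a` when `ω = 0`. -/
def expQuot (a ω : ℝ) : ℝ := if ω = 0 then a else ω⁻¹ * (Real.exp (a * ω) - 1)

/-- `c(b) = b e^{aω} (1 - b ω⁻¹ (e^{aω} - 1))⁻¹`. -/
def outType (a ω b : ℝ) : ℝ := b * Real.exp (a * ω) * (1 - b * expQuot a ω)⁻¹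

/-- The `k`-th term of the series `∑_k φ^{(k)}(0) / k! · (Δ_{θ,ω}^k f)(z)` that defines
`(φ(Δ_{θ,ω}) f)(z)`. -/
def opTerm (θ ω : ℝ) (φ f : ℂ → ℂ) (z : ℂ) (k : ℕ) : ℂ :=
  iteratedDeriv k φ 0 / (k.factorial : ℂ) * ((lagDelta θ ω)^[k] f) z

end

/-! Estimates. On the sequence `F n` of derivatives at 0, Δ acts by `F n ↦ (θ + n) F (n+1) + ω n F
n`, with nonnegative coefficients, so it is monotone. Geometric bounds on the derivatives of φ and f
therefore reduce everything to φ = e^{az}, f = e^{bz}. There the evolution equation u_t = Δu has the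
explicit solution (1 - bq)^{-θ} e^{cz} with q = `expQuot a ω`, c = `outType a ω b`, and it dominates
the partial sums of the exponential series (`sum_seqDelta_iterate_pow_le`). Applied with slightly
larger a, b, this gives absolute convergence and the type c; as the bound is bilinear, it also gives
continuity (`exists_opMap`).

Roots. If p has all its roots in (-∞, 0] and z = s² with Re s > 0, then (κp + Δp)/p at z is κ plus
twice the second elementary symmetric function of numbers with nonnegative real part. By
Cauchy–Schwarz this does not vanish once two of the real parts are positive. So each κ + Δ with κ ≥
0 preserves such polynomials (`NonposRooted.add_polyDelta`), and factoring φ gives the same for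
φ(Δ).

Passage to the limit. Up to a phase, a Laguerre entire function is a limit of such polynomials whose
coefficients are nonnegative and lie below those of the limit (`IsLaguerreEntire.exists_approx`), so
dominated convergence carries φ(Δ)f to the limit. Conversely, a pointwise limit of such polynomials
that is nonzero at 1 is Laguerre entire, by compactness of the suitably normalized roots
(`IsLaguerreEntire.of_tendsto`). -/

noncomputable section

open Polynomial
open Filter Topology

/-! ### Polynomials with roots in (-∞, 0] and their invariance under φ(Δ) -/

/-- All complex roots of `p` lie in `(-∞, 0]`. The zero polynomial is included. -/
def NonposRooted (p : ℂ[X]) : Prop := ∀ z ∈ p.roots, ∃ r : ℝ, 0 ≤ r ∧ z = -(r : ℂ)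

/-- The operator `Δ_{θ,ω}` on polynomials. -/
def polyDelta (θ ω : ℝ) : ℂ[X] →ₗ[ℂ] ℂ[X] :=
  (θ : ℂ) • derivative + LinearMap.mulLeft ℂ X ∘ₗ derivative ∘ₗ derivative +
    (ω : ℂ) • (LinearMap.mulLeft ℂ X ∘ₗ derivative)

theorem eval_polyDelta (θ ω : ℝ) (p : ℂ[X]) (z : ℂ) :
    (polyDelta θ ω p).eval z = θ * (derivative p).eval z
      + z * (derivative (derivative p)).eval z + ω * z * (derivative p).eval z := by
  simp [polyDelta, mul_assoc]

/-- The second elementary symmetric function of numbers in the open right half-plane (one of them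
possibly zero) omits `(-∞, 0]`. -/
theorem sum_sq_sub_sum_sq_add_ne_zero {ι : Type*} (s : Finset ι) (u : ι → ℂ)
    (hu : ∀ i ∈ s, 0 ≤ (u i).re) {i j : ι} (hi : i ∈ s) (hj : j ∈ s) (hij : i ≠ j)
    (hui : 0 < (u i).re) (huj : 0 < (u j).re) {κ : ℝ} (hκ : 0 ≤ κ) :
    (κ : ℂ) + ((∑ k ∈ s, u k) ^ 2 - ∑ k ∈ s, u k ^ 2) ≠ 0 := by
  classical
  intro h
  have hre := congrArg Complex.re h
  have him := congrArg Complex.im h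
  simp only [pow_two, Complex.add_re, Complex.sub_re, Complex.mul_re, Complex.re_sum,
    Complex.im_sum, Complex.ofReal_re, Complex.zero_re, Complex.add_im, Complex.sub_im,
    Complex.mul_im, Complex.ofReal_im, Complex.zero_im, Finset.sum_sub_distrib,
    Finset.sum_add_distrib] at hre him
  -- With A, B the sums of the real and imaginary parts x, y, and P, Q, R the sums of x², y², xy, a
  -- zero would mean R = AB and B² = κ + (A² - P) + Q. Cauchy–Schwarz, R² ≤ PQ, then contradicts P <
  -- A², which is strict because two of the x are positive.
  have hcs := Finset.sum_mul_sq_le_sq_mul_sq s (fun k => (u k).re) (fun k => (u k).im)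
  simp only [pow_two] at hcs
  have hcomm : ∑ k ∈ s, (u k).im * (u k).re = ∑ k ∈ s, (u k).re * (u k).im :=
    Finset.sum_congr rfl fun k _ => mul_comm _ _
  have hlt : ∑ k ∈ s, (u k).re * (u k).re < (∑ k ∈ s, (u k).re) * ∑ k ∈ s, (u k).re := by
    rw [Finset.sum_mul]
    refine Finset.sum_lt_sum (fun k hk => ?_) ⟨i, hi, ?_⟩
    · exact mul_le_mul_of_nonneg_left (Finset.single_le_sum (f := fun k => (u k).re) hu hk)
        (hu k hk)
    · refine mul_lt_mul_of_pos_left ?_ hui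
      exact Finset.single_lt_sum (f := fun k => (u k).re) hij.symm hi hj huj
        fun k hk _ => hu k hk
  have hA0 : 0 ≤ ∑ k ∈ s, (u k).re * (u k).re := Finset.sum_nonneg fun k _ => mul_self_nonneg _
  have hB0 : 0 ≤ ∑ k ∈ s, (u k).im * (u k).im := Finset.sum_nonneg fun k _ => mul_self_nonneg _
  set A := ∑ k ∈ s, (u k).re
  set B := ∑ k ∈ s, (u k).im
  set P := ∑ k ∈ s, (u k).re * (u k).re
  set Q := ∑ k ∈ s, (u k).im * (u k).im
  set R := ∑ k ∈ s, (u k).re * (u k).im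
  have hR : R = A * B := by linarith
  rw [hR] at hcs
  have hBB : B * B = κ + (A * A - P) + Q := by linarith
  have h1 : A * A * (κ + (A * A - P) + Q) ≤ P * Q := by
    rw [← hBB]; calc _ = A * B * (A * B) := by ring
      _ ≤ _ := hcs
  nlinarith [mul_nonneg (sub_nonneg.2 hlt.le) hB0, mul_pos (lt_of_le_of_lt hA0 hlt) (sub_pos.2 hlt),
    mul_nonneg (lt_of_le_of_lt hA0 hlt).le hκ]

/-- Logarithmic differentiation, in the form that makes Δp/p a quadratic expression in the numbers
1/(z + r i). -/
theorem derivative_prod_X_add_C {n : ℕ} (r : Fin n → ℂ) {z : ℂ} (hz : ∀ i, z + r i ≠ 0) :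
    (derivative (∏ i, (X + C (r i)))).eval z = (∏ i, (z + r i)) * ∑ i, (z + r i)⁻¹ ∧
    (derivative (derivative (∏ i, (X + C (r i))))).eval z
      = (∏ i, (z + r i)) * ((∑ i, (z + r i)⁻¹) ^ 2 - ∑ i, (z + r i)⁻¹ ^ 2) := by
  induction n with
  | zero => simp
  | succ n ih =>
    obtain ⟨h1, h2⟩ := ih (fun i => r i.succ) fun i => hz _
    have h0 := hz 0
    have hp : (∏ i : Fin n, (X + C (r i.succ))).eval z = ∏ i : Fin n, (z + r i.succ) := by
      simp [eval_prod]
    simp only [Fin.prod_univ_succ, Fin.sum_univ_succ, derivative_mul, derivative_add, derivative_X,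
      derivative_C, add_zero, one_mul, eval_add, eval_mul, eval_X, eval_C, h1, h2, hp]
    constructor
    · field_simp
    · field_simp
      ring

theorem NonposRooted.exists_fin {p : ℂ[X]} (hp : NonposRooted p) :
    ∃ (n : ℕ) (r : Fin n → ℝ), (∀ i, 0 ≤ r i) ∧
      p = C p.leadingCoeff * ∏ i, (X + C (r i : ℂ)) := by
  set l := p.roots.toList with hl
  have hmem : ∀ i : Fin l.length, ∃ r : ℝ, 0 ≤ r ∧ l.get i = -(r : ℂ) := fun i =>
    hp _ (by rw [← Multiset.mem_toList]; exact List.get_mem _ _)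
  choose r hr hrl using hmem
  refine ⟨l.length, r, hr, ?_⟩
  have hs := IsAlgClosed.splits p
  conv_lhs => rw [hs.eq_prod_roots]
  congr 1
  have : p.roots = ((List.ofFn l.get : List ℂ) : Multiset ℂ) := by
    rw [List.ofFn_get, hl, Multiset.coe_toList]
  rw [this]
  simp only [Multiset.map_coe, Multiset.prod_coe, List.map_ofFn, List.prod_ofFn]
  refine Finset.prod_congr rfl fun i _ => ?_
  simp only [Function.comp_apply, hrl]
  simp

/-- The number s/(s² + r) is the inverse of s + r/s, and inversion preserves the open right
half-plane. -/
theorem inv_add_div_re_pos {s : ℂ} (hs : 0 < s.re) {r : ℝ} (hr : 0 ≤ r) :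
    s ^ 2 + r ≠ 0 ∧ 0 < (s * (s ^ 2 + r)⁻¹).re := by
  have hs0 : s ≠ 0 := fun h => by simp [h] at hs
  have hinv : 0 < (s⁻¹).re := by
    rw [Complex.inv_re]; exact div_pos hs (Complex.normSq_pos.2 hs0)
  have h1 : 0 < (s + r * s⁻¹).re := by
    rw [Complex.add_re, Complex.re_ofReal_mul]
    positivity
  have h2 : s ^ 2 + r = s * (s + r * s⁻¹) := by field_simp
  have h3 : s + r * s⁻¹ ≠ 0 := fun h => by simp [h] at h1
  refine ⟨by rw [h2]; exact mul_ne_zero hs0 h3, ?_⟩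
  have h4 : s * (s ^ 2 + r)⁻¹ = (s + r * s⁻¹)⁻¹ := by rw [h2, mul_inv, mul_inv_cancel_left₀ hs0]
  rw [h4, Complex.inv_re]
  exact div_pos h1 (Complex.normSq_pos.2 h3)

theorem exists_sq_eq_re_pos {z : ℂ} (hz : ¬ ∃ r : ℝ, 0 ≤ r ∧ z = -(r : ℂ)) :
    ∃ s : ℂ, 0 < s.re ∧ s ^ 2 = z := by
  obtain ⟨s, hs⟩ := IsAlgClosed.exists_pow_nat_eq z (n := 2) two_pos
  rcases lt_trichotomy s.re 0 with h | h | h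
  · exact ⟨-s, by simpa using h, by rw [← hs]; ring⟩
  · refine (hz ⟨s.im ^ 2, sq_nonneg _, ?_⟩).elim
    rw [← hs]
    apply Complex.ext <;> simp [pow_two, h]
  · exact ⟨s, h, hs⟩

/-- `κ + Δ_{θ,ω}` preserves the polynomials whose roots lie in `(-∞, 0]`. -/
theorem NonposRooted.add_polyDelta {θ ω κ : ℝ} (hθ : 0 ≤ θ) (hω : 0 ≤ ω) (hκ : 0 ≤ κ) {p : ℂ[X]}
    (hp : NonposRooted p) : NonposRooted ((κ : ℂ) • p + polyDelta θ ω p) := by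
  intro z hz
  by_contra hcon
  obtain ⟨s, hs, rfl⟩ := exists_sq_eq_re_pos hcon
  have hs0 : s ≠ 0 := fun h => by simp [h] at hs
  obtain ⟨n, r, hr, hpr⟩ := hp.exists_fin
  have hne : (κ : ℂ) • p + polyDelta θ ω p ≠ 0 := fun h => by rw [h] at hz; simp at hz
  have hroot := (mem_roots hne).1 hz
  have hlc : p.leadingCoeff ≠ 0 := fun h => hne (by rw [leadingCoeff_eq_zero.1 h]; simp)
  have hsr : ∀ i, s ^ 2 + (r i : ℂ) ≠ 0 := fun i => (inv_add_div_re_pos hs (hr i)).1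
  obtain ⟨hd1, hd2⟩ := derivative_prod_X_add_C (fun i => (r i : ℂ)) hsr
  -- The extra number μ absorbs the first-order terms: 2μ · s/(s² + r) = (θ + ωs²)/(s² + r). Hence
  -- (κp + Δp)/p at s² is κ + (∑ u)² - ∑ u².
  set μ : ℂ := (θ * s⁻¹ + ω * s) / 2 with hμ
  have hinv : 0 < (s⁻¹).re := by
    rw [Complex.inv_re]; exact div_pos hs (Complex.normSq_pos.2 hs0)
  have hμre : μ.re = (θ * (s⁻¹).re + ω * s.re) / 2 := by
    rw [hμ, show (2 : ℂ) = ((2 : ℝ) : ℂ) by norm_num, Complex.div_ofReal_re, Complex.add_re,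
      Complex.re_ofReal_mul, Complex.re_ofReal_mul]
  set u : Option (Fin n) → ℂ := fun o => o.elim μ fun i => s * (s ^ 2 + r i)⁻¹ with hu
  have hval : (κ : ℂ) + ((∑ k, u k) ^ 2 - ∑ k, u k ^ 2) = 0 := by
    have hP : ∏ i, (s ^ 2 + (r i : ℂ)) ≠ 0 := Finset.prod_ne_zero_iff.2 fun i _ => hsr i
    have hev : p.leadingCoeff * (∏ i, (s ^ 2 + (r i : ℂ))) *
        ((κ : ℂ) + ((∑ k, u k) ^ 2 - ∑ k, u k ^ 2)) = 0 := by
      rw [← hroot.eq_zero, eval_add, eval_smul, eval_polyDelta, hpr]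
      simp only [derivative_C_mul, eval_C_mul, hd1, hd2, Fintype.sum_option, hu, Option.elim,
        ← Finset.mul_sum, mul_pow, smul_eq_mul, leadingCoeff_mul, leadingCoeff_C, eval_prod,
        eval_add, eval_X, eval_C]
      have hmon : (∏ i, (X + C (r i : ℂ))).leadingCoeff = 1 :=
        (monic_prod_of_monic _ _ fun i _ => monic_X_add_C _).leadingCoeff
      rw [hmon, hμ]
      field_simp
      ring
    exact (mul_eq_zero.1 hev).resolve_left (mul_ne_zero hlc hP)
  have hupos : ∀ i, 0 < (u (some i)).re := fun i => (inv_add_div_re_pos hs (hr i)).2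
  have hμ0 : 0 ≤ μ.re := by rw [hμre]; positivity
  have hunn : ∀ k ∈ Finset.univ, 0 ≤ (u k).re := by
    rintro (_ | i) _
    · exact hμ0
    · exact (hupos i).le
  -- Two numbers of positive real part are available if n ≥ 2, or if n = 1 and Re μ > 0. In the
  -- remaining cases p is constant, or linear with θ = ω = 0, and Δp = 0; then κp vanishes at s²
  -- while p does not, so κ = 0.
  have hdeg : polyDelta θ ω p = 0 := by
    clear_value u
    obtain rfl | rfl | hn : n = 0 ∨ n = 1 ∨ 2 ≤ n := by omega
    · rw [hpr]
      simp [polyDelta]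
    · have h0 : ¬ 0 < μ.re := fun hμp =>
        sum_sq_sub_sum_sq_add_ne_zero Finset.univ u hunn (Finset.mem_univ (some 0))
          (Finset.mem_univ none) (by simp) (hupos _) (by rw [hu]; exact hμp) hκ hval
      have h1 : 0 ≤ θ * (s⁻¹).re := by positivity
      have h2 : 0 ≤ ω * s.re := by positivity
      have hθ0 : θ = 0 :=
        (mul_eq_zero.1 (show θ * (s⁻¹).re = 0 by linarith)).resolve_right hinv.ne'
      have hω0 : ω = 0 := (mul_eq_zero.1 (show ω * s.re = 0 by linarith)).resolve_right hs.ne'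
      rw [hpr, hθ0, hω0]
      simp [polyDelta]
    · exact (sum_sq_sub_sum_sq_add_ne_zero Finset.univ u hunn (Finset.mem_univ (some ⟨0, by omega⟩))
        (Finset.mem_univ (some ⟨1, by omega⟩)) (by simp [Fin.ext_iff]) (hupos _) (hupos _) hκ hval).elim
  have hpz : p.eval (s ^ 2) ≠ 0 := by
    rw [hpr, eval_C_mul, eval_prod]
    refine mul_ne_zero hlc (Finset.prod_ne_zero_iff.2 fun i _ => ?_)
    simpa using hsr i
  have hκz : (κ : ℂ) = 0 := by
    have h := hroot.eq_zero
    rw [hdeg, add_zero, eval_smul, smul_eq_mul] at h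
    exact (mul_eq_zero.1 h).resolve_right hpz
  exact hne (by rw [hdeg, hκz]; simp)

theorem NonposRooted.smul {p : ℂ[X]} (hp : NonposRooted p) (c : ℂ) : NonposRooted (c • p) := by
  by_cases hc : c = 0
  · simp [hc, NonposRooted]
  · unfold NonposRooted
    rwa [roots_smul_nonzero _ hc]

theorem NonposRooted.aeval_polyDelta {θ ω : ℝ} (hθ : 0 ≤ θ) (hω : 0 ≤ ω) {φ p : ℂ[X]}
    (hφ : NonposRooted φ) (hp : NonposRooted p) : NonposRooted (aeval (polyDelta θ ω) φ p) := by
  obtain ⟨n, r, hr, h⟩ := hφ.exists_fin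
  have key : ∀ (n : ℕ) (r : Fin n → ℝ), (∀ i, 0 ≤ r i) →
      NonposRooted (aeval (polyDelta θ ω) (∏ i, (X + C (r i : ℂ))) p) := by
    intro n
    induction n with
    | zero => intro r _; simpa using hp
    | succ n ih =>
      intro r hr
      rw [Fin.prod_univ_succ, map_mul, Module.End.mul_apply]
      have := (ih (fun i => r i.succ) fun i => hr _).add_polyDelta hθ hω (hr 0)
      simpa [add_comm, Algebra.algebraMap_eq_smul_one] using this
  rw [h, map_mul, Module.End.mul_apply]
  simpa [Algebra.algebraMap_eq_smul_one] using (key n r hr).smul φ.leadingCoeff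

theorem NonposRooted.mul {p q : ℂ[X]} (hp : NonposRooted p) (hq : NonposRooted q) :
    NonposRooted (p * q) := by
  by_cases h : p * q = 0
  · simp [h, NonposRooted]
  · intro z hz
    rw [roots_mul h, Multiset.mem_add] at hz
    exact hz.elim (hp z) (hq z)

theorem nonposRooted_one : NonposRooted 1 := by simp [NonposRooted]

theorem NonposRooted.prod {ι : Type*} {s : Finset ι} {p : ι → ℂ[X]}
    (hp : ∀ i ∈ s, NonposRooted (p i)) : NonposRooted (∏ i ∈ s, p i) :=
  Finset.prod_induction p NonposRooted (fun _ _ => NonposRooted.mul) nonposRooted_one hp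

theorem NonposRooted.pow {p : ℂ[X]} (hp : NonposRooted p) (n : ℕ) : NonposRooted (p ^ n) := by
  simpa using NonposRooted.prod (s := Finset.range n) fun _ _ => hp

theorem nonposRooted_X : NonposRooted X := by
  intro z hz
  exact ⟨0, le_rfl, by simpa using hz⟩

theorem nonposRooted_one_add_C_mul_X {β : ℝ} (hβ : 0 ≤ β) :
    NonposRooted (1 + C (β : ℂ) * X) := by
  intro z hz
  have h := (mem_roots'.1 hz).2
  simp only [IsRoot.def, eval_add, eval_one, eval_mul, eval_C, eval_X] at h
  have hβ0 : β ≠ 0 := fun h0 => by simp [h0] at h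
  refine ⟨β⁻¹, by positivity, ?_⟩
  have : (β : ℂ) ≠ 0 := by exact_mod_cast hβ0
  push_cast
  field_simp
  linear_combination h

/-! ### Pointwise limits of polynomials with roots in (-∞, 0] -/

/-- Expanding at 1 instead of 0 turns a root -r into β = 1/(1 + r), which stays in [0, 1] even if r
tends to 0 or to infinity; this is what makes compactness available. -/
theorem NonposRooted.exists_antitone {p : ℂ[X]} (hp : NonposRooted p) :
    ∃ (N : ℕ) (β : ℕ → ℝ), Antitone β ∧ (∀ j, 0 ≤ β j) ∧ (∀ j, β j ≤ 1) ∧ (∀ j, N ≤ j → β j = 0) ∧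
      ∀ z, p.eval z = p.eval 1 * ∏ j ∈ Finset.range N, (1 + (β j : ℂ) * (z - 1)) := by
  obtain ⟨n, r, hr, h⟩ := hp.exists_fin
  have hmono := Tuple.monotone_sort r
  set τ := Tuple.sort r
  have hr1 : ∀ i, (1 : ℝ) ≤ 1 + r i := fun i => by linarith [hr i]
  refine ⟨n, fun j => if hj : j < n then (1 + r (τ ⟨j, hj⟩))⁻¹ else 0, ?_, ?_, ?_, ?_, ?_⟩
  · intro i j hij
    dsimp only
    split_ifs with h1 h2
    · have := hmono (show (⟨i, h2⟩ : Fin n) ≤ ⟨j, h1⟩ from hij)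
      simp only [Function.comp_apply] at this
      exact inv_anti₀ (lt_of_lt_of_le one_pos (hr1 _)) (by linarith)
    · omega
    · exact inv_nonneg.2 (zero_le_one.trans (hr1 _))
    · exact le_rfl
  · intro j
    dsimp only
    split_ifs
    · exact inv_nonneg.2 (zero_le_one.trans (hr1 _))
    · exact le_rfl
  · intro j
    dsimp only
    split_ifs
    · exact inv_le_one_of_one_le₀ (hr1 _)
    · exact zero_le_one
  · intro j hj
    exact dif_neg (by omega)
  · intro z
    rw [Finset.prod_range]
    have he : ∀ w : ℂ, p.eval w = p.leadingCoeff * ∏ i, (w + (r (τ i) : ℂ)) := by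
      intro w
      conv_lhs => rw [h]
      rw [eval_C_mul, eval_prod, Equiv.prod_comp τ fun i => w + (r i : ℂ)]
      simp
    rw [he, he, mul_assoc, ← Finset.prod_mul_distrib]
    congr 1
    refine Finset.prod_congr rfl fun i _ => ?_
    have : (1 + (r (τ i) : ℂ)) ≠ 0 := by
      have := hr1 (τ i)
      norm_cast
      linarith
    simp only [Fin.is_lt, dite_true, Fin.eta]
    push_cast
    field_simp
    ring

theorem summable_norm_ofReal_mul {β : ℕ → ℝ} (hβ : Summable β) (w : ℂ) :
    Summable fun j => ‖(β j : ℂ) * w‖ := by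
  simpa [norm_mul] using hβ.abs.mul_right ‖w‖

/-- In a limit of such products part of the mass of ∑ β j can escape to infinite indices. Splitting
off the exponential leaves factors that differ from 1 only quadratically in β j, and these do pass
to the limit. The shape `1 + (… - 1)` suits dominated convergence for products. -/
theorem tprod_one_add_eq_exp_mul {β : ℕ → ℝ} (hβ : Summable β) (w : ℂ) :
    ∏' j, (1 + (β j : ℂ) * w) =
      Complex.exp ((∑' j, β j : ℝ) * w) *
        ∏' j, (1 + ((1 + (β j : ℂ) * w) * Complex.exp (-(β j * w)) - 1)) := by
  have h1 : HasProd (fun j => Complex.exp (-(β j * w))) (Complex.exp (-((∑' j, β j : ℝ) * w))) := by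
    have : HasSum (fun j => (β j : ℂ)) ((∑' j, β j : ℝ) : ℂ) := by exact_mod_cast hβ.hasSum
    exact (this.mul_right w).neg.cexp
  have h2 := (multipliable_one_add_of_summable (summable_norm_ofReal_mul hβ w)).hasProd
  have h3 := (h2.mul h1).tprod_eq
  simp only [add_sub_cancel]
  rw [h3, mul_comm, mul_assoc, ← Complex.exp_add]
  simp

theorem norm_one_add_mul_exp_neg_sub_one_le (x : ℂ) :
    ‖(1 + x) * Complex.exp (-x) - 1‖ ≤ ‖x‖ ^ 2 * Real.exp (2 * ‖x‖) := by
  have h1 : (1 + x) * Complex.exp (-x) - 1 = -(Complex.exp (-x) * (Complex.exp x - (1 + x))) := by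
    rw [mul_sub, ← Complex.exp_add]
    simp
    ring
  have h2 := Complex.norm_exp_sub_sum_le_norm_mul_exp x 2
  simp only [Finset.sum_range_succ, Finset.sum_range_zero, pow_zero, pow_one, Nat.factorial,
    Nat.cast_one, div_one, zero_add, mul_one] at h2
  rw [h1, norm_neg, norm_mul]
  have h3 : ‖Complex.exp (-x)‖ ≤ Real.exp ‖x‖ := by
    simpa using Complex.norm_exp_le_exp_norm (-x)
  calc _ ≤ Real.exp ‖x‖ * (‖x‖ ^ 2 * Real.exp ‖x‖) := by gcongr
    _ = _ := by rw [two_mul, Real.exp_add]; ring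

/-- The finitely many factors with b j = 1 give z^m. Each other factor is 1 + b(z - 1) = (1 - b)(1 +
b/(1 - b) · z), with 1 - b bounded below. -/
theorem IsLaguerreEntire.of_expansion_at_one {g : ℂ → ℂ} {α : ℝ} {b : ℕ → ℝ} (hα : 0 ≤ α)
    (hb : Antitone b) (hb0 : ∀ j, 0 ≤ b j) (hb1 : ∀ j, b j ≤ 1) (hbs : Summable b) (K : ℂ)
    (hg : ∀ z, g z = K * Complex.exp (α * (z - 1)) * ∏' j, (1 + (b j : ℂ) * (z - 1))) :
    IsLaguerreEntire g := by
  classical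
  obtain ⟨m, hm, hlt⟩ : ∃ m, b m < 1 ∧ ∀ j, j < m → b j = 1 := by
    have hex : ∃ m, b m < 1 :=
      (hbs.tendsto_atTop_zero.eventually (gt_mem_nhds one_pos)).exists
    exact ⟨Nat.find hex, Nat.find_spec hex, fun j hj =>
      le_antisymm (hb1 j) (not_lt.1 (Nat.find_min hex hj))⟩
  have hge : ∀ j, 0 < 1 - b (j + m) := fun j => by
    have := hb (Nat.le_add_left m j)
    linarith
  have hsm : Summable fun j => b (j + m) := (summable_nat_add_iff m).2 hbs
  have hγ : Summable fun j => b (j + m) / (1 - b (j + m)) := by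
    refine Summable.of_nonneg_of_le (fun j => div_nonneg (hb0 _) (hge j).le) (fun j => ?_)
      (hsm.div_const (1 - b m))
    have := hb (Nat.le_add_left m j)
    exact div_le_div_of_nonneg_left (hb0 _) (by linarith) (by linarith)
  refine ⟨K * Complex.exp (-α) * ∏' j, (1 + ((-b (j + m) : ℝ) : ℂ) * 1), m, α,
    fun j => b (j + m) / (1 - b (j + m)), hα, ?_, fun j => div_nonneg (hb0 _) (hge j).le, hγ, ?_⟩
  · intro i j hij
    have h1 : b (j + m) ≤ b (i + m) := hb (by omega)
    exact div_le_div₀ (hb0 _) h1 (hge i) (by linarith)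
  · intro z
    have hmul : ∀ j, 1 + (b (j + m) : ℂ) * (z - 1) = (1 + ((-b (j + m) : ℝ) : ℂ) * 1) *
        (1 + ((b (j + m) / (1 - b (j + m)) : ℝ) : ℂ) * z) := by
      intro j
      have : (1 - (b (j + m) : ℂ)) ≠ 0 := by exact_mod_cast (hge j).ne'
      push_cast
      field_simp
      ring
    have htail : ∏' j, (1 + (b (j + m) : ℂ) * (z - 1)) = (∏' j, (1 + ((-b (j + m) : ℝ) : ℂ) * 1)) *
        ∏' j, (1 + ((b (j + m) / (1 - b (j + m)) : ℝ) : ℂ) * z) := by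
      rw [← Multipliable.tprod_mul
        (multipliable_one_add_of_summable (summable_norm_ofReal_mul hsm.neg 1))
        (multipliable_one_add_of_summable (summable_norm_ofReal_mul hγ z))]
      exact tprod_congr hmul
    have hhead : ∏ j ∈ Finset.range m, (1 + (b j : ℂ) * (z - 1)) = z ^ m := by
      refine (Finset.prod_eq_pow_card fun j hj => ?_).trans (by rw [Finset.card_range])
      rw [hlt j (Finset.mem_range.1 hj)]
      simp
    have hsplit : ∏' j, (1 + (b j : ℂ) * (z - 1)) =
        z ^ m * ∏' j, (1 + (b (j + m) : ℂ) * (z - 1)) := by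
      have hmt : Multipliable fun j => 1 + (b (j + m) : ℂ) * (z - 1) :=
        multipliable_one_add_of_summable (summable_norm_ofReal_mul hsm (z - 1))
      have h := Multipliable.prod_mul_tprod_nat_mul' (f := fun j => 1 + (b j : ℂ) * (z - 1)) hmt
      rw [← h, hhead]
    have hexp : Complex.exp (α * (z - 1)) = Complex.exp (-α) * Complex.exp (α * z) := by
      rw [← Complex.exp_add]; ring_nf
    rw [hg, hsplit, htail, hexp]
    ac_rfl

theorem one_add_sum_le_prod_one_add {ι : Type*} (s : Finset ι) {x : ι → ℝ}
    (hx : ∀ i ∈ s, 0 ≤ x i) : 1 + ∑ i ∈ s, x i ≤ ∏ i ∈ s, (1 + x i) := by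
  classical
  induction s using Finset.induction_on with
  | empty => simp
  | insert i s hi ih =>
    have h := ih fun j hj => hx j (Finset.mem_insert_of_mem hj)
    have h1 := hx i (Finset.mem_insert_self i s)
    have h2 : 0 ≤ ∑ j ∈ s, x j := Finset.sum_nonneg fun j hj => hx j (Finset.mem_insert_of_mem hj)
    rw [Finset.sum_insert hi, Finset.prod_insert hi]
    nlinarith [mul_nonneg h1 h2, mul_le_mul_of_nonneg_left h (add_nonneg zero_le_one h1)]

/-- A pointwise limit of polynomials whose roots lie in `(-∞, 0]` is a Laguerre entire function, if
it does not vanish at `1`. -/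
theorem IsLaguerreEntire.of_tendsto {p : ℕ → ℂ[X]} (hp : ∀ n, NonposRooted (p n)) {g : ℂ → ℂ}
    (hlim : ∀ z, Tendsto (fun n => (p n).eval z) atTop (𝓝 (g z))) (hg1 : g 1 ≠ 0) :
    IsLaguerreEntire g := by
  choose N β hanti h0 h1 hfin hprod using fun n => (hp n).exists_antitone
  have hsum : ∀ n, Summable (β n) := fun n =>
    summable_of_ne_finset_zero (s := Finset.range (N n)) fun j hj =>
      hfin n j (by simpa using hj)
  have hprod' : ∀ n z, (p n).eval z = (p n).eval 1 * ∏' j, (1 + (β n j : ℂ) * (z - 1)) := by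
    intro n z
    rw [hprod, tprod_eq_prod (s := Finset.range (N n))]
    intro j hj
    rw [hfin n j (by simpa using hj)]
    simp
  have hratio : Tendsto (fun n => ‖(p n).eval 2 / (p n).eval 1‖) atTop (𝓝 ‖g 2 / g 1‖) :=
    ((hlim 2).div (hlim 1) hg1).norm
  -- All factors at z = 2 equal 1 + β j, so |p(2)/p(1)| is at least 1 + ∑ β j; this bounds the sums
  -- uniformly.
  have hev : ∀ᶠ n in atTop, ∑' j, β n j ≤ ‖g 2 / g 1‖ + 1 := by
    filter_upwards [hratio.eventually (gt_mem_nhds (lt_add_one _)),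
      (hlim 1).eventually_ne hg1] with n hn hn1
    refine le_trans ?_ hn.le
    rw [tsum_eq_sum (s := Finset.range (N n)) fun j hj => hfin n j (by simpa using hj)]
    rw [hprod, mul_div_cancel_left₀ _ hn1, norm_prod]
    calc ∑ j ∈ Finset.range (N n), β n j ≤ 1 + ∑ j ∈ Finset.range (N n), β n j := by linarith
      _ ≤ ∏ j ∈ Finset.range (N n), (1 + β n j) := 
        one_add_sum_le_prod_one_add _ fun j _ => h0 n j
      _ = _ := by
        refine Finset.prod_congr rfl fun j _ => ?_
        rw [show (1 + (β n j : ℂ) * (2 - 1)) = ((1 + β n j : ℝ) : ℂ) by push_cast; ring,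
          Complex.norm_real, Real.norm_of_nonneg (by linarith [h0 n j])]
  obtain ⟨N₀, hN₀⟩ := eventually_atTop.1 hev
  set S := ‖g 2 / g 1‖ + 1
  -- The total ∑ β j is kept as a coordinate of its own, since it is not continuous in β for the
  -- product topology.
  have hcpt : IsCompact (Set.Icc (0 : ℝ) S ×ˢ Set.pi Set.univ fun _ : ℕ => Set.Icc (0 : ℝ) 1) :=
    isCompact_Icc.prod (isCompact_univ_pi fun _ => isCompact_Icc)
  obtain ⟨⟨σ, b⟩, -, ψ, hψ, hψlim⟩ := hcpt.tendsto_subseq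
    (x := fun n => (∑' j, β (n + N₀) j, β (n + N₀)))
    fun n => ⟨⟨tsum_nonneg (h0 _), hN₀ _ (by omega)⟩, fun j _ => ⟨h0 _ j, h1 _ j⟩⟩
  set χ : ℕ → ℕ := fun n => ψ n + N₀
  have hχ : Tendsto χ atTop atTop := tendsto_atTop_mono (fun n => Nat.le_add_right _ _) hψ.tendsto_atTop
  have hχS : ∀ n, ∑' j, β (χ n) j ≤ S := fun n => hN₀ _ (by simp [χ])
  have hσ : Tendsto (fun n => ∑' j, β (χ n) j) atTop (𝓝 σ) := (Prod.tendsto_iff _ _).1 hψlim |>.1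
  have hbl : ∀ j, Tendsto (fun n => β (χ n) j) atTop (𝓝 (b j)) := fun j =>
    (tendsto_pi_nhds.1 ((Prod.tendsto_iff _ _).1 hψlim).2) j
  have hb0 : ∀ j, 0 ≤ b j := fun j => ge_of_tendsto' (hbl j) fun n => h0 _ j
  have hb1 : ∀ j, b j ≤ 1 := fun j => le_of_tendsto' (hbl j) fun n => h1 _ j
  have hba : Antitone b := fun i j hij =>
    le_of_tendsto_of_tendsto' (hbl j) (hbl i) fun n => hanti _ hij
  have hpart : ∀ s : Finset ℕ, ∑ j ∈ s, b j ≤ σ := fun s =>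
    le_of_tendsto_of_tendsto' (tendsto_finsetSum s fun j _ => hbl j) hσ fun n =>
      (hsum _).sum_le_tsum s fun j _ => h0 _ j
  have hbs : Summable b := summable_of_sum_le hb0 hpart
  -- The mass lost in the limit, σ - ∑ b j, becomes the exponent α.
  have hα : 0 ≤ σ - ∑' j, b j := sub_nonneg.2 (hbs.tsum_le_of_sum_le hpart)
  -- A decreasing sequence of sum at most S has β j ≤ S/(j + 1); the squares are then dominated by a
  -- summable sequence independent of n.
  have hdom : ∀ n j, β (χ n) j ≤ S / (j + 1) := by
    intro n j
    rw [le_div_iff₀ (by positivity)]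
    calc β (χ n) j * (j + 1) = ∑ i ∈ Finset.range (j + 1), β (χ n) j := by simp; ring
      _ ≤ ∑ i ∈ Finset.range (j + 1), β (χ n) i :=
        Finset.sum_le_sum fun i hi => hanti _ (by simpa [Nat.lt_succ_iff] using hi)
      _ ≤ ∑' i, β (χ n) i := (hsum _).sum_le_tsum _ fun i _ => h0 _ i
      _ ≤ S := hχS n
  refine IsLaguerreEntire.of_expansion_at_one hα hba hb0 hb1 hbs (g 1) fun z => ?_
  set w := z - 1
  have hprodlim : Tendsto (fun n => ∏' j, (1 + ((1 + (β (χ n) j : ℂ) * w) *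
      Complex.exp (-(β (χ n) j * w)) - 1))) atTop
      (𝓝 (∏' j, (1 + ((1 + (b j : ℂ) * w) * Complex.exp (-(b j * w)) - 1)))) := by
    refine tendsto_tprod_one_add_of_dominated_convergence
      (bound := fun j : ℕ => (S * ‖w‖) ^ 2 * Real.exp (2 * ‖w‖) * (1 / ((j : ℝ) + 1) ^ 2)) ?_ ?_ ?_
    · refine Summable.mul_left _ ?_
      exact_mod_cast (summable_nat_add_iff 1).2 (Real.summable_one_div_nat_pow.2 one_lt_two)
    · intro j
      have : Tendsto (fun n => (β (χ n) j : ℂ)) atTop (𝓝 (b j : ℂ)) :=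
        (Complex.continuous_ofReal.tendsto _).comp (hbl j)
      have hcont : Continuous fun x : ℂ => (1 + x * w) * Complex.exp (-(x * w)) - 1 := by fun_prop
      exact (hcont.tendsto _).comp this
    · refine Eventually.of_forall fun n j => (norm_one_add_mul_exp_neg_sub_one_le _).trans ?_
      have hn : ‖(β (χ n) j : ℂ) * w‖ = β (χ n) j * ‖w‖ := by
        rw [norm_mul, Complex.norm_real, Real.norm_of_nonneg (h0 _ j)]
      rw [hn]
      calc (β (χ n) j * ‖w‖) ^ 2 * Real.exp (2 * (β (χ n) j * ‖w‖))
          ≤ (S / (j + 1) * ‖w‖) ^ 2 * Real.exp (2 * (1 * ‖w‖)) := by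
            have := h0 (χ n) j
            have := hdom n j
            have := h1 (χ n) j
            gcongr
        _ = _ := by field_simp
  have hexp : Tendsto (fun n => Complex.exp ((∑' j, β (χ n) j : ℝ) * w)) atTop
      (𝓝 (Complex.exp (σ * w))) := by
    have hcont : Continuous fun x : ℝ => Complex.exp (x * w) := by fun_prop
    exact (hcont.tendsto _).comp hσ
  have hl := (((hlim 1).comp hχ).mul (hexp.mul hprodlim))
  have hr := (hlim z).comp hχ
  have heq : ((fun n => (p n).eval z) ∘ χ) = fun n => ((fun n => (p n).eval 1) ∘ χ) n *
      (Complex.exp ((∑' j, β (χ n) j : ℝ) * w) * ∏' j, (1 + ((1 + (β (χ n) j : ℂ) * w) *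
      Complex.exp (-(β (χ n) j * w)) - 1))) := by
    funext n
    simp only [Function.comp_apply]
    rw [hprod', tprod_one_add_eq_exp_mul (hsum _)]
  rw [heq] at hr
  rw [tendsto_nhds_unique hr hl, tprod_one_add_eq_exp_mul hbs, mul_assoc (g 1),
    ← mul_assoc (Complex.exp _), ← Complex.exp_add, ← add_mul, ← Complex.ofReal_add,
    sub_add_cancel]

theorem IsLaguerreEntire.const_mul {g : ℂ → ℂ} (hg : IsLaguerreEntire g) (c : ℂ) :
    IsLaguerreEntire fun z => c * g z := by
  obtain ⟨C, m, α, β, h1, h2, h3, h4, h5⟩ := hg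
  exact ⟨c * C, m, α, β, h1, h2, h3, h4, fun z => by simp only [h5]; ring⟩

theorem isLaguerreEntire_zero : IsLaguerreEntire fun _ => 0 :=
  ⟨0, 0, 0, 0, le_rfl, antitone_const, fun _ => le_rfl, summable_zero, fun z => by simp⟩

/-! ### Δ on sequences of derivatives at 0 -/

section SeqDelta

variable {E : Type*} [AddCommGroup E] [Module ℝ E]

/-- The action of `Δ_{θ,ω}` on the sequence of the derivatives at `0`. -/
def seqDelta (θ ω : ℝ) (F : ℕ → E) : ℕ → E :=
  fun n => (θ + n) • F (n + 1) + (ω * n) • F n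

theorem seqDelta_iterate_add (θ ω : ℝ) (F G : ℕ → E) (k : ℕ) :
    (seqDelta θ ω)^[k] (F + G) = (seqDelta θ ω)^[k] F + (seqDelta θ ω)^[k] G := by
  induction k generalizing F G with
  | zero => rfl
  | succ k ih =>
    simp only [Function.iterate_succ_apply, ← ih]
    congr 1
    funext n
    simp only [seqDelta, Pi.add_apply, smul_add]
    abel

theorem seqDelta_iterate_smul {R : Type*} [Monoid R] [DistribMulAction R E] [SMulCommClass R ℝ E]
    (θ ω : ℝ) (c : R) (F : ℕ → E) (k : ℕ) :
    (seqDelta θ ω)^[k] (c • F) = c • (seqDelta θ ω)^[k] F := by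
  induction k generalizing F with
  | zero => rfl
  | succ k ih =>
    simp only [Function.iterate_succ_apply, ← ih]
    congr 1
    funext n
    simp only [seqDelta, Pi.smul_apply, smul_add, smul_comm c]

theorem seqDelta_sum {ι : Type*} (θ ω : ℝ) (s : Finset ι) (c : ι → ℝ) (F : ι → ℕ → E) (n : ℕ) :
    seqDelta θ ω (fun m => ∑ i ∈ s, c i • F i m) n = ∑ i ∈ s, c i • seqDelta θ ω (F i) n := by
  simp only [seqDelta, Finset.smul_sum, smul_add, Finset.sum_add_distrib, smul_comm (c _)]

end SeqDelta

/-- The weights θ + n and ωn are nonnegative. All later majorizations rest on this. -/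
theorem seqDelta_mono {θ ω : ℝ} (hθ : 0 ≤ θ) (hω : 0 ≤ ω) :
    Monotone (seqDelta θ ω : (ℕ → ℝ) → ℕ → ℝ) := by
  intro F G h n
  have h1 := h (n + 1)
  have h2 := h n
  simp only [seqDelta, smul_eq_mul]
  gcongr

theorem seqDelta_iterate_nonneg {θ ω : ℝ} (hθ : 0 ≤ θ) (hω : 0 ≤ ω) {F : ℕ → ℝ} (hF : 0 ≤ F)
    (k : ℕ) : 0 ≤ (seqDelta θ ω)^[k] F := by
  have h : (seqDelta θ ω)^[k] (0 : ℕ → ℝ) = 0 := by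
    simpa using seqDelta_iterate_smul θ ω (0 : ℝ) (0 : ℕ → ℝ) k
  rw [← h]
  exact (seqDelta_mono hθ hω).iterate k hF

theorem norm_seqDelta_iterate_le {E : Type*} [NormedAddCommGroup E] [NormedSpace ℝ E] {θ ω : ℝ}
    (hθ : 0 ≤ θ) (hω : 0 ≤ ω) (F : ℕ → E) (k n : ℕ) :
    ‖(seqDelta θ ω)^[k] F n‖ ≤ (seqDelta θ ω)^[k] (fun m => ‖F m‖) n := by
  induction k generalizing F n with
  | zero => exact le_rfl
  | succ k ih =>
    simp only [Function.iterate_succ_apply]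
    refine (ih _ n).trans ((seqDelta_mono hθ hω).iterate k (fun m => ?_) n)
    simp only [seqDelta, smul_eq_mul]
    refine (norm_add_le _ _).trans ?_
    rw [norm_smul, norm_smul, Real.norm_of_nonneg (by positivity),
      Real.norm_of_nonneg (by positivity)]

theorem seqDelta_iterate_ofReal (θ ω : ℝ) (F : ℕ → ℝ) (k n : ℕ) :
    (seqDelta θ ω)^[k] (fun m => (F m : ℂ)) n = (((seqDelta θ ω)^[k] F n : ℝ) : ℂ) := by
  induction k generalizing F with
  | zero => rfl
  | succ k ih =>
    simp only [Function.iterate_succ_apply, ← ih]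
    refine congrArg (fun G => (seqDelta θ ω)^[k] G n) (funext fun m => ?_)
    simp [seqDelta]

theorem tendsto_seqDelta_iterate {ι E : Type*} [NormedAddCommGroup E] [NormedSpace ℝ E]
    {l : Filter ι} (θ ω : ℝ) {F : ι → ℕ → E} {G : ℕ → E}
    (h : ∀ n, Tendsto (fun i => F i n) l (𝓝 (G n))) (k n : ℕ) :
    Tendsto (fun i => (seqDelta θ ω)^[k] (F i) n) l (𝓝 ((seqDelta θ ω)^[k] G n)) := by
  induction k generalizing F G with
  | zero => exact h n
  | succ k ih =>
    simp only [Function.iterate_succ_apply]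
    exact ih fun m => ((h (m + 1)).const_smul _).add ((h m).const_smul _)

/-! ### The evolution equation with exponential initial data -/

section Flow

theorem hasDerivAt_expQuot (ω t : ℝ) : HasDerivAt (fun t => expQuot t ω) (Real.exp (t * ω)) t := by
  by_cases hω : ω = 0
  · simpa [expQuot, hω] using hasDerivAt_id' t
  · simp only [expQuot, hω, if_false]
    have h : HasDerivAt (fun t : ℝ => t * ω) ω t := by simpa using (hasDerivAt_id t).mul_const ω
    refine ((h.exp.sub_const 1).const_mul ω⁻¹).congr_deriv ?_
    field_simp

theorem expQuot_mono (ω : ℝ) : Monotone fun t => expQuot t ω :=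
  monotone_of_deriv_nonneg (fun t => (hasDerivAt_expQuot ω t).differentiableAt) fun t => by
    rw [(hasDerivAt_expQuot ω t).deriv]; positivity

theorem expQuot_zero (ω : ℝ) : expQuot 0 ω = 0 := by simp [expQuot]

/-- The coefficients of `exp(t Δ_{θ,ω})` applied to `z ↦ exp(b z)`. -/
def flowCoeff (θ ω b t : ℝ) (n : ℕ) : ℝ :=
  (1 - b * expQuot t ω) ^ (-θ) * outType t ω b ^ n

/-- The ansatz h(t) e^{u(t)z} solves the equation u_t = Δu for functions of (t, z) when u' = u² + ωu
and h' = θuh; `outType` and (1 - bq)^{-θ} solve these. -/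
theorem hasDerivAt_flowCoeff (θ ω b : ℝ) {t : ℝ} (ht : b * expQuot t ω < 1) (n : ℕ) :
    HasDerivAt (fun t => flowCoeff θ ω b t n) (seqDelta θ ω (flowCoeff θ ω b t) n) t := by
  have hD : 0 < 1 - b * expQuot t ω := by linarith
  have hd : HasDerivAt (fun t => 1 - b * expQuot t ω) (-(b * Real.exp (t * ω))) t := by
    simpa using ((hasDerivAt_expQuot ω t).const_mul b).const_sub 1
  have he : HasDerivAt (fun t : ℝ => b * Real.exp (t * ω)) (b * (Real.exp (t * ω) * ω)) t := by
    have h : HasDerivAt (fun t : ℝ => t * ω) ω t := by simpa using (hasDerivAt_id t).mul_const ω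
    exact h.exp.const_mul b
  have hu : HasDerivAt (fun t => outType t ω b) (outType t ω b ^ 2 + ω * outType t ω b) t := by
    refine (he.mul (hd.inv hD.ne')).congr_deriv ?_
    simp only [outType, Pi.inv_apply]
    field_simp
    ring
  have hh : HasDerivAt (fun t => (1 - b * expQuot t ω) ^ (-θ))
      (θ * outType t ω b * (1 - b * expQuot t ω) ^ (-θ)) t := by
    refine (hd.rpow_const (p := -θ) (Or.inl hD.ne')).congr_deriv ?_
    rw [Real.rpow_sub_one hD.ne', outType]
    field_simp
  refine (hh.mul (hu.pow n)).congr_deriv ?_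
  simp only [seqDelta, flowCoeff, smul_eq_mul, Pi.pow_apply]
  rcases n with _ | n
  · simp
    ring
  · simp only [Nat.add_sub_cancel, pow_succ]
    push_cast
    ring

theorem flowCoeff_zero (θ ω b : ℝ) (n : ℕ) : flowCoeff θ ω b 0 n = b ^ n := by
  simp [flowCoeff, outType, expQuot_zero]

theorem flowCoeff_nonneg {θ ω b t : ℝ} (hb : 0 ≤ b) (ht : b * expQuot t ω < 1) (n : ℕ) :
    0 ≤ flowCoeff θ ω b t n := by
  have hD : 0 < 1 - b * expQuot t ω := by linarith
  unfold flowCoeff outType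
  positivity

/-- The t-derivative of the partial sum with N + 1 terms is Δ applied to the one with N terms. By
induction and monotonicity it is at most the derivative of the flow, and both sides start from b^n
at t = 0. No prior convergence of the exponential series is needed. -/
theorem sum_seqDelta_iterate_pow_le {θ ω a b : ℝ} (hθ : 0 ≤ θ) (hω : 0 ≤ ω) (hb : 0 ≤ b)
    (hab : b * expQuot a ω < 1) (N : ℕ) {t : ℝ} (ht : t ∈ Set.Icc 0 a) (n : ℕ) :
    ∑ k ∈ Finset.range N, (t ^ k / k.factorial) • (seqDelta θ ω)^[k] (fun m => b ^ m) n
      ≤ flowCoeff θ ω b t n := by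
  have hlt : ∀ t ≤ a, b * expQuot t ω < 1 := fun t ht =>
    lt_of_le_of_lt (mul_le_mul_of_nonneg_left (expQuot_mono ω ht) hb) hab
  induction N generalizing t n with
  | zero => simpa using flowCoeff_nonneg hb (hlt t ht.2) n
  | succ N ih =>
    set e : ℕ → ℝ := fun m => b ^ m with he
    have hder : ∀ t : ℝ, HasDerivAt (fun t : ℝ => ∑ k ∈ Finset.range (N + 1),
        (t ^ k / k.factorial) • (seqDelta θ ω)^[k] e n)
        (seqDelta θ ω (fun m => ∑ k ∈ Finset.range N,
          (t ^ k / k.factorial) • (seqDelta θ ω)^[k] e m) n) t := by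
      intro t
      rw [seqDelta_sum]
      simp only [Finset.sum_range_succ' _ N]
      rw [← add_zero (∑ k ∈ Finset.range N, (t ^ k / (k.factorial : ℝ)) •
        seqDelta θ ω ((seqDelta θ ω)^[k] e) n)]
      refine HasDerivAt.add ?_ (by simpa using hasDerivAt_const t _)
      refine HasDerivAt.fun_sum fun k _ => ?_
      simp only [Function.iterate_succ_apply', smul_eq_mul]
      refine HasDerivAt.mul_const ?_ _
      refine ((hasDerivAt_pow (k + 1) t).div_const ((k + 1).factorial : ℝ)).congr_deriv ?_
      have : (k.factorial : ℝ) ≠ 0 := by positivity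
      rw [Nat.factorial_succ]
      push_cast
      field_simp
    refine image_le_of_deriv_right_le_deriv_boundary (a := 0) (b := a)
      (fun t _ => (hder t).continuousAt.continuousWithinAt)
      (fun t _ => (hder t).hasDerivWithinAt) ?_
      (fun t ht => (hasDerivAt_flowCoeff θ ω b (hlt t ht.2) n).continuousAt.continuousWithinAt)
      (fun t ht => (hasDerivAt_flowCoeff θ ω b (hlt t ht.2.le) n).hasDerivWithinAt)
      (fun t ht => seqDelta_mono hθ hω (fun m => ih ⟨ht.1, ht.2.le⟩ m) n) ht
    rw [flowCoeff_zero, Finset.sum_range_succ']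
    simp [he]

end Flow

/-! ### Majorants for the derivatives of φ(Δ)f -/

/-- The derivatives at `0` of `φ(Δ_{θ,ω}) f`, in terms of those of `φ` and `f`. -/
def opCoeff {K : Type*} [RCLike K] (θ ω : ℝ) (Φ F : ℕ → K) (n : ℕ) : K :=
  ∑' k, Φ k / (k.factorial : K) * (seqDelta θ ω)^[k] F n

/-- By monotonicity A and B may be replaced by M a^k and N b^k, which is the exponential case at
time t = a. -/
theorem sum_opCoeff_le {θ ω a b M N : ℝ} (hθ : 0 ≤ θ) (hω : 0 ≤ ω) (ha : 0 ≤ a) (hb : 0 ≤ b)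
    (hab : b * expQuot a ω < 1) (hM : 0 ≤ M) {A B : ℕ → ℝ} (hB0 : 0 ≤ B)
    (hA : ∀ k, A k ≤ M * a ^ k) (hB : ∀ k, B k ≤ N * b ^ k) (m n : ℕ) :
    ∑ k ∈ Finset.range m, A k / k.factorial * (seqDelta θ ω)^[k] B n
      ≤ M * N * flowCoeff θ ω b a n := by
  have hN : 0 ≤ N := by simpa using (hB0 0).trans (hB 0)
  have h1 : ∀ k, (seqDelta θ ω)^[k] B n ≤ N * (seqDelta θ ω)^[k] (fun m => b ^ m) n := by
    intro k
    have h := (seqDelta_mono hθ hω).iterate k (show B ≤ N • fun m => b ^ m from hB) n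
    rwa [seqDelta_iterate_smul] at h
  calc ∑ k ∈ Finset.range m, A k / k.factorial * (seqDelta θ ω)^[k] B n
      ≤ ∑ k ∈ Finset.range m, M * a ^ k / k.factorial *
        (N * (seqDelta θ ω)^[k] (fun m => b ^ m) n) := by
        refine Finset.sum_le_sum fun k _ => ?_
        have h2 := seqDelta_iterate_nonneg hθ hω hB0 k n
        have h3 := hA k
        exact mul_le_mul (by gcongr) (h1 k) h2 (by positivity)
    _ = M * N * ∑ k ∈ Finset.range m, (a ^ k / k.factorial) •
        (seqDelta θ ω)^[k] (fun m => b ^ m) n := by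
        rw [Finset.mul_sum]
        refine Finset.sum_congr rfl fun k _ => ?_
        simp only [smul_eq_mul]
        ring
    _ ≤ _ := by
        gcongr
        exact sum_seqDelta_iterate_pow_le hθ hω hb hab m ⟨ha, le_rfl⟩ n

theorem opCoeff_term_nonneg {θ ω : ℝ} (hθ : 0 ≤ θ) (hω : 0 ≤ ω) {A B : ℕ → ℝ} (hA : 0 ≤ A)
    (hB : 0 ≤ B) (n k : ℕ) : 0 ≤ A k / (k.factorial : ℝ) * (seqDelta θ ω)^[k] B n :=
  mul_nonneg (div_nonneg (hA k) (by positivity)) (seqDelta_iterate_nonneg hθ hω hB k n)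

theorem summable_opCoeff_real {θ ω a b M N : ℝ} (hθ : 0 ≤ θ) (hω : 0 ≤ ω) (ha : 0 ≤ a)
    (hb : 0 ≤ b) (hab : b * expQuot a ω < 1) {A B : ℕ → ℝ} (hA0 : 0 ≤ A) (hB0 : 0 ≤ B)
    (hA : ∀ k, A k ≤ M * a ^ k) (hB : ∀ k, B k ≤ N * b ^ k) (n : ℕ) :
    Summable (fun k => A k / (k.factorial : ℝ) * (seqDelta θ ω)^[k] B n) ∧
      opCoeff θ ω A B n ≤ M * N * flowCoeff θ ω b a n := by
  have hM : 0 ≤ M := by simpa using (hA0 0).trans (hA 0)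
  have h := fun m => sum_opCoeff_le hθ hω ha hb hab hM hB0 hA hB m n
  exact ⟨summable_of_sum_range_le (opCoeff_term_nonneg hθ hω hA0 hB0 n) h,
    Real.tsum_le_of_sum_range_le (opCoeff_term_nonneg hθ hω hA0 hB0 n) h⟩

theorem norm_opCoeff_term_le {θ ω : ℝ} (hθ : 0 ≤ θ) (hω : 0 ≤ ω) (Φ F : ℕ → ℂ) (n k : ℕ) :
    ‖Φ k / (k.factorial : ℂ) * (seqDelta θ ω)^[k] F n‖ ≤
      ‖Φ k‖ / (k.factorial : ℝ) * (seqDelta θ ω)^[k] (fun m => ‖F m‖) n := by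
  rw [norm_mul, norm_div, Complex.norm_natCast]
  gcongr
  exact norm_seqDelta_iterate_le hθ hω F k n

theorem summable_opCoeff {θ ω a b M N : ℝ} (hθ : 0 ≤ θ) (hω : 0 ≤ ω) (ha : 0 ≤ a)
    (hb : 0 ≤ b) (hab : b * expQuot a ω < 1) {Φ F : ℕ → ℂ}
    (hΦ : ∀ k, ‖Φ k‖ ≤ M * a ^ k) (hF : ∀ k, ‖F k‖ ≤ N * b ^ k) (n : ℕ) :
    Summable (fun k => Φ k / (k.factorial : ℂ) * (seqDelta θ ω)^[k] F n) ∧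
      ‖opCoeff θ ω Φ F n‖ ≤ M * N * flowCoeff θ ω b a n := by
  obtain ⟨h1, h2⟩ := summable_opCoeff_real hθ hω ha hb hab (A := fun k => ‖Φ k‖)
    (B := fun k => ‖F k‖) (fun _ => norm_nonneg _) (fun _ => norm_nonneg _) hΦ hF n
  exact ⟨Summable.of_norm_bounded h1 (norm_opCoeff_term_le hθ hω Φ F n),
    (tsum_of_norm_bounded h1.hasSum (norm_opCoeff_term_le hθ hω Φ F n)).trans h2⟩

/-! ### Entire functions and their derivatives at 0 -/

section PowerSeries

theorem hasSum_iteratedDeriv_of_entire {f : ℂ → ℂ} (hf : Differentiable ℂ f) (z : ℂ) :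
    HasSum (fun n : ℕ => iteratedDeriv n f 0 * (z ^ n / (n.factorial : ℂ))) (f z) := by
  refine (Complex.hasSum_taylorSeries_of_entire hf 0 z).congr_fun fun n => ?_
  simp only [sub_zero, smul_eq_mul]
  ring

theorem entire_of_hasSum {G : ℕ → ℂ} {g : ℂ → ℂ}
    (h : ∀ z, HasSum (fun n : ℕ => G n * (z ^ n / (n.factorial : ℂ))) (g z)) :
    Differentiable ℂ g ∧ ∀ n, iteratedDeriv n g 0 = G n := by
  set p := FormalMultilinearSeries.ofScalars ℂ (fun n => G n / (n.factorial : ℂ)) with hp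
  have hps : HasFPowerSeriesOnBall g p 0 ⊤ := by
    refine ⟨?_, ENNReal.zero_lt_top, fun {y} _ => ?_⟩
    · rw [FormalMultilinearSeries.radius_eq_top_of_summable_norm]
      intro r
      refine (h (r : ℝ)).summable.norm.congr fun n => ?_
      rw [hp, FormalMultilinearSeries.ofScalars_norm]
      simp
      ring
    · rw [zero_add]
      refine (h y).congr_fun fun n => ?_
      rw [hp, FormalMultilinearSeries.ofScalars_apply_eq]
      simp
      ring
  refine ⟨?_, fun n => ?_⟩
  · have := hps.differentiableOn
    rwa [Metric.eball_top, differentiableOn_univ] at this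
  · have h1 := hps.factorial_smul 1 n
    rw [← iteratedDeriv_eq_iteratedFDeriv, hp, FormalMultilinearSeries.ofScalars_apply_eq] at h1
    rw [← h1]
    have : (n.factorial : ℂ) ≠ 0 := by exact_mod_cast n.factorial_ne_zero
    simp
    field_simp

theorem iteratedDeriv_mul_id_zero {g : ℂ → ℂ} (hg : Differentiable ℂ g) (n : ℕ) :
    iteratedDeriv n (fun z => z * g z) 0 = n * iteratedDeriv (n - 1) g 0 := by
  rw [iteratedDeriv_fun_mul (f := fun z => z) contDiffAt_id hg.contDiff.contDiffAt]
  simp only [iteratedDeriv_fun_id_zero]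
  rw [Finset.sum_eq_single 1]
  · simp
  · intro i _ hi
    simp [hi]
  · intro h
    have : n = 0 := by simpa using h
    simp [this]

theorem differentiable_lagDelta {f : ℂ → ℂ} (hf : Differentiable ℂ f) (θ ω : ℝ) :
    Differentiable ℂ (lagDelta θ ω f) := by
  have h1 : Differentiable ℂ (deriv f) := hf.deriv
  have h2 : Differentiable ℂ (deriv (deriv f)) := h1.deriv
  unfold lagDelta
  fun_prop

theorem iteratedDeriv_lagDelta {f : ℂ → ℂ} (hf : Differentiable ℂ f) (θ ω : ℝ) :
    (fun n => iteratedDeriv n (lagDelta θ ω f) 0) = seqDelta θ ω fun n => iteratedDeriv n f 0 := by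
  funext n
  have h1 : Differentiable ℂ (deriv f) := hf.deriv
  have h2 : Differentiable ℂ (deriv (deriv f)) := h1.deriv
  have e : lagDelta θ ω f = ((θ : ℂ) • deriv f + fun z => z * deriv (deriv f) z) +
      (ω : ℂ) • fun z => z * deriv f z := by
    funext z
    simp [lagDelta, mul_assoc]
  have h3 : Differentiable ℂ fun z => z * deriv (deriv f) z := by fun_prop
  have h4 : Differentiable ℂ fun z => z * deriv f z := by fun_prop
  rw [e, iteratedDeriv_add_of_entire ((h1.const_smul _).add h3) (h4.const_smul _),
    iteratedDeriv_add_of_entire (h1.const_smul _) h3, iteratedDeriv_smul_at_zero,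
    iteratedDeriv_smul_at_zero, iteratedDeriv_mul_id_zero h2, iteratedDeriv_mul_id_zero h1,
    ← iteratedDeriv_succ']
  rcases n with _ | n
  · simp [seqDelta]
  · simp only [Nat.add_sub_cancel, ← iteratedDeriv_succ', seqDelta, Complex.real_smul]
    push_cast
    ring

theorem lagDelta_iterate {f : ℂ → ℂ} (hf : Differentiable ℂ f) (θ ω : ℝ) (k : ℕ) :
    Differentiable ℂ ((lagDelta θ ω)^[k] f) ∧ (fun n => iteratedDeriv n ((lagDelta θ ω)^[k] f) 0) =
      (seqDelta θ ω)^[k] fun n => iteratedDeriv n f 0 := by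
  induction k with
  | zero => exact ⟨hf, rfl⟩
  | succ k ih =>
    simp only [Function.iterate_succ_apply']
    exact ⟨differentiable_lagDelta ih.1 θ ω, by rw [iteratedDeriv_lagDelta ih.1, ih.2]⟩

end PowerSeries

/-! ### The double series in k and in powers of z -/

theorem summable_geometric_div_factorial (K c x : ℝ) :
    Summable fun n : ℕ => K * c ^ n * (x ^ n / (n.factorial : ℝ)) := by
  refine ((Real.summable_pow_div_factorial (c * x)).mul_left K).congr fun n => ?_
  rw [mul_pow]
  ring

theorem summable_prod_mul_of_nonneg {t : ℕ → ℕ → ℝ} {x : ℕ → ℝ} (ht : ∀ n k, 0 ≤ t n k)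
    (hx : ∀ n, 0 ≤ x n) (h1 : ∀ n, Summable (t n)) (h2 : Summable fun n => (∑' k, t n k) * x n) :
    Summable fun q : ℕ × ℕ => t q.1 q.2 * x q.1 := by
  have h0 : (0 : ℕ × ℕ → ℝ) ≤ fun q => t q.1 q.2 * x q.1 := fun q => mul_nonneg (ht _ _) (hx _)
  refine (summable_prod_of_nonneg h0).2 ⟨fun n => (h1 n).mul_right (x n), ?_⟩
  simpa only [tsum_mul_right] using h2

theorem exists_hasSum_rows_columns {t : ℕ → ℕ → ℂ} {r c : ℕ → ℂ}
    (h : Summable fun q : ℕ × ℕ => t q.1 q.2) (hr : ∀ n, HasSum (t n) (r n))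
    (hc : ∀ k, HasSum (fun n => t n k) (c k)) : ∃ y, HasSum c y ∧ HasSum r y :=
  ⟨_, ((Equiv.prodComm ℕ ℕ).hasSum_iff.2 h.hasSum).prod_fiberwise hc, h.hasSum.prod_fiberwise hr⟩

/-- Summing norms over k first leaves a geometric sequence in n, which the weights |z|^n/n! make
summable. This justifies exchanging the two summations. -/
theorem summable_opCoeff_double {θ ω a b M N : ℝ} (hθ : 0 ≤ θ) (hω : 0 ≤ ω) (ha : 0 ≤ a)
    (hb : 0 ≤ b) (hab : b * expQuot a ω < 1) {Φ F : ℕ → ℂ}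
    (hΦ : ∀ k, ‖Φ k‖ ≤ M * a ^ k) (hF : ∀ k, ‖F k‖ ≤ N * b ^ k) (z : ℂ) :
    Summable fun q : ℕ × ℕ => Φ q.2 / (q.2.factorial : ℂ) *
      (seqDelta θ ω)^[q.2] F q.1 * (z ^ q.1 / (q.1.factorial : ℂ)) := by
  have hreal := summable_opCoeff_real hθ hω ha hb hab (A := fun k => ‖Φ k‖)
    (B := fun k => ‖F k‖) (fun _ => norm_nonneg _) (fun _ => norm_nonneg _) hΦ hF
  have hnn := opCoeff_term_nonneg hθ hω (A := fun k => ‖Φ k‖) (B := fun k => ‖F k‖)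
    (fun _ => norm_nonneg _) (fun _ => norm_nonneg _)
  have hgeo : Summable fun n : ℕ => M * N * flowCoeff θ ω b a n *
      (‖z‖ ^ n / (n.factorial : ℝ)) := by
    refine (summable_geometric_div_factorial
      (M * N * (1 - b * expQuot a ω) ^ (-θ)) (outType a ω b) ‖z‖).congr fun n => ?_
    rw [flowCoeff]
    ring
  have hx : ∀ n : ℕ, 0 ≤ ‖z‖ ^ n / (n.factorial : ℝ) := fun n => by positivity
  have hsum := summable_prod_mul_of_nonneg (t := fun n k => ‖Φ k‖ / (k.factorial : ℝ) *
    (seqDelta θ ω)^[k] (fun k => ‖F k‖) n) (x := fun n => ‖z‖ ^ n / (n.factorial : ℝ))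
    hnn hx (fun n => (hreal n).1)
    (Summable.of_nonneg_of_le (fun n => mul_nonneg (tsum_nonneg (hnn n)) (hx n))
      (fun n => mul_le_mul_of_nonneg_right (hreal n).2 (hx n)) hgeo)
  refine Summable.of_norm_bounded hsum fun q => ?_
  rw [norm_mul, norm_div (z ^ q.1), norm_pow, Complex.norm_natCast]
  exact mul_le_mul_of_nonneg_right (norm_opCoeff_term_le hθ hω Φ F q.1 q.2) (hx q.1)

/-- The series for `φ(Δ_{θ,ω}) f` can be summed by powers of `z`. -/
theorem exists_hasSum_opTerm {θ ω a b M N : ℝ} (hθ : 0 ≤ θ) (hω : 0 ≤ ω) (ha : 0 ≤ a)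
    (hb : 0 ≤ b) (hab : b * expQuot a ω < 1) {φ f : ℂ → ℂ} (hf : Differentiable ℂ f)
    (hΦ : ∀ k, ‖iteratedDeriv k φ 0‖ ≤ M * a ^ k) (hF : ∀ k, ‖iteratedDeriv k f 0‖ ≤ N * b ^ k)
    (z : ℂ) :
    ∃ y, HasSum (opTerm θ ω φ f z) y ∧
      HasSum (fun n : ℕ => opCoeff θ ω (fun k => iteratedDeriv k φ 0)
        (fun k => iteratedDeriv k f 0) n * (z ^ n / (n.factorial : ℂ))) y := by
  refine exists_hasSum_rows_columns (t := fun n k => iteratedDeriv k φ 0 / (k.factorial : ℂ) *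
      (seqDelta θ ω)^[k] (fun k => iteratedDeriv k f 0) n * (z ^ n / (n.factorial : ℂ)))
    (summable_opCoeff_double hθ hω ha hb hab hΦ hF z)
    (fun n => (summable_opCoeff hθ hω ha hb hab hΦ hF n).1.hasSum.mul_right _) fun k => ?_
  obtain ⟨h1, h2⟩ := lagDelta_iterate hf θ ω k
  have h3 := (hasSum_iteratedDeriv_of_entire h1 z).mul_left
    (iteratedDeriv k φ 0 / (k.factorial : ℂ))
  refine h3.congr_fun fun n => ?_
  rw [← h2, mul_assoc]

/-- Members of 𝒜_a obey geometric bounds only for rates above a. The condition on a, b is open and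
`outType` is continuous, so both parameters can be raised by a small ε. -/
theorem exists_lt_params {ω a b c : ℝ} (hab : b * expQuot a ω < 1) (hc : outType a ω b < c) :
    ∃ a' b', a < a' ∧ b < b' ∧ b' * expQuot a' ω < 1 ∧ outType a' ω b' < c := by
  have hq : ContinuousAt (fun ε : ℝ => expQuot (a + ε) ω) 0 := by
    have h : Continuous fun t => expQuot t ω :=
      continuous_iff_continuousAt.2 fun t => (hasDerivAt_expQuot ω t).continuousAt
    exact (h.comp (continuous_const.add continuous_id)).continuousAt
  have hbq : ContinuousAt (fun ε : ℝ => (b + ε) * expQuot (a + ε) ω) 0 :=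
    (by fun_prop : ContinuousAt (fun ε : ℝ => b + ε) 0).mul hq
  have hu : ContinuousAt (fun ε : ℝ => outType (a + ε) ω (b + ε)) 0 := by
    unfold outType
    refine ContinuousAt.mul (by fun_prop) ((continuousAt_const.sub hbq).inv₀ ?_)
    have : 0 < 1 - (b + 0) * expQuot (a + 0) ω := by simpa using hab
    exact this.ne'
  have e1 : ∀ᶠ ε in 𝓝[>] (0 : ℝ), (b + ε) * expQuot (a + ε) ω < 1 :=
    nhdsWithin_le_nhds (hbq.eventually_lt continuousAt_const (by simpa using hab))
  have e2 : ∀ᶠ ε in 𝓝[>] (0 : ℝ), outType (a + ε) ω (b + ε) < c :=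
    nhdsWithin_le_nhds (hu.eventually_lt continuousAt_const (by simpa using hc))
  obtain ⟨ε, ⟨h1, h2⟩, h3⟩ := ((e1.and e2).and self_mem_nhdsWithin).exists
  have h3 : 0 < ε := h3
  exact ⟨a + ε, b + ε, by linarith, by linarith, h1, h2⟩

theorem ExpNormFinite.norm_iteratedDeriv_le {b : ℝ} (hb : 0 < b) {f : ℂ → ℂ}
    (hf : ExpNormFinite b f) (k : ℕ) : ‖iteratedDeriv k f 0‖ ≤ expNorm b f * b ^ k := by
  have h := le_ciSup hf k
  rw [inv_mul_le_iff₀ (by positivity)] at h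
  rw [mul_comm]
  exact h

theorem outType_nonneg {ω a b : ℝ} (hb : 0 ≤ b) (hab : b * expQuot a ω < 1) :
    0 ≤ outType a ω b := by
  have : 0 < 1 - b * expQuot a ω := by linarith
  unfold outType
  positivity

/-- The derivatives at `0` of an element of `𝒜_a`. -/
def ExpType.coeff {a : ℝ} (f : ExpType a) (n : ℕ) : ℂ := iteratedDeriv n f 0

theorem ExpType.coeff_add {a : ℝ} (f g : ExpType a) : (f + g).coeff = f.coeff + g.coeff :=
  funext fun k => iteratedDeriv_add_of_entire f.2.1 g.2.1 k

theorem ExpType.norm_coeff_le {a : ℝ} (f : ExpType a) (b : {b : ℝ // 0 < b ∧ a < b}) (k : ℕ) :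
    ‖f.coeff k‖ ≤ expSeminorm a b f * (b : ℝ) ^ k :=
  (f.2.2 b b.2.1 b.2.2).norm_iteratedDeriv_le b.2.1 k

/-! ### The operator on 𝒜_a × 𝒜_b and its continuity -/

section Operator

variable {θ ω a b : ℝ}

/-- The bound behind both convergence and continuity. -/
theorem exists_opCoeff_bound (hθ : 0 ≤ θ) (hω : 0 ≤ ω) (ha : 0 ≤ a) (hb : 0 ≤ b)
    (hab : b * expQuot a ω < 1) {c : ℝ} (hc : outType a ω b < c) :
    ∃ (a' : {x : ℝ // 0 < x ∧ a < x}) (b' : {x : ℝ // 0 < x ∧ b < x}) (K : ℝ), 0 ≤ K ∧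
      (b' : ℝ) * expQuot a' ω < 1 ∧
      ∀ (φ : ExpType a) (f : ExpType b) (n : ℕ),
        ‖opCoeff θ ω φ.coeff f.coeff n‖ ≤
          K * expSeminorm a a' φ * expSeminorm b b' f * c ^ n := by
  obtain ⟨a', b', haa, hbb, hab', hc'⟩ := exists_lt_params hab hc
  have ha' : 0 < a' := ha.trans_lt haa
  have hb' : 0 < b' := hb.trans_lt hbb
  have hD : 0 < 1 - b' * expQuot a' ω := by linarith
  refine ⟨⟨a', ha', haa⟩, ⟨b', hb', hbb⟩, (1 - b' * expQuot a' ω) ^ (-θ), by positivity, hab',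
    fun φ f n => ?_⟩
  refine (summable_opCoeff hθ hω ha'.le hb'.le hab' (φ.norm_coeff_le ⟨a', ha', haa⟩)
    (f.norm_coeff_le ⟨b', hb', hbb⟩) n).2.trans ?_
  have h1 : outType a' ω b' ^ n ≤ c ^ n := pow_le_pow_left₀ (outType_nonneg hb'.le hab') hc'.le n
  have h2 := apply_nonneg (expSeminorm a ⟨a', ha', haa⟩) φ
  have h3 := apply_nonneg (expSeminorm b ⟨b', hb', hbb⟩) f
  calc _ = (1 - b' * expQuot a' ω) ^ (-θ) * expSeminorm a ⟨a', ha', haa⟩ φ *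
        expSeminorm b ⟨b', hb', hbb⟩ f * outType a' ω b' ^ n := by
        simp only [flowCoeff]; ring
    _ ≤ _ := by gcongr

theorem summable_opCoeff_expType (hθ : 0 ≤ θ) (hω : 0 ≤ ω) (ha : 0 ≤ a) (hb : 0 ≤ b)
    (hab : b * expQuot a ω < 1) (φ : ExpType a) (f : ExpType b) (n : ℕ) :
    Summable fun k => φ.coeff k / (k.factorial : ℂ) * (seqDelta θ ω)^[k] f.coeff n := by
  -- Only a' and b' matter here; any number above `outType a ω b` would serve.
  obtain ⟨a', b', -, -, hab', -⟩ := exists_opCoeff_bound hθ hω ha hb hab (lt_add_one _)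
  exact (summable_opCoeff hθ hω a'.2.1.le b'.2.1.le hab' (φ.norm_coeff_le a')
    (f.norm_coeff_le b') n).1

/-- The bilinear splitting behind continuity at (φ₀, f₀): each term on the right contains one
difference. -/
theorem opCoeff_sub_sub (hθ : 0 ≤ θ) (hω : 0 ≤ ω) (ha : 0 ≤ a) (hb : 0 ≤ b)
    (hab : b * expQuot a ω < 1) (φ φ₀ : ExpType a) (f f₀ : ExpType b) (n : ℕ) :
    opCoeff θ ω φ.coeff f.coeff n - opCoeff θ ω φ₀.coeff f₀.coeff n =
      opCoeff θ ω (φ - φ₀).coeff f.coeff n + opCoeff θ ω φ₀.coeff (f - f₀).coeff n := by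
  have hs := fun (φ : ExpType a) (f : ExpType b) =>
    summable_opCoeff_expType hθ hω ha hb hab φ f n
  have h1 : opCoeff θ ω φ.coeff f.coeff n =
      opCoeff θ ω (φ - φ₀).coeff f.coeff n + opCoeff θ ω φ₀.coeff f.coeff n := by
    unfold opCoeff
    rw [← (hs _ _).tsum_add (hs _ _)]
    refine tsum_congr fun k => ?_
    have : φ.coeff k = (φ - φ₀).coeff k + φ₀.coeff k := by
      rw [← Pi.add_apply, ← ExpType.coeff_add, sub_add_cancel]
    rw [this]
    ring
  have h2 : opCoeff θ ω φ₀.coeff f.coeff n =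
      opCoeff θ ω φ₀.coeff (f - f₀).coeff n + opCoeff θ ω φ₀.coeff f₀.coeff n := by
    unfold opCoeff
    rw [← (hs _ _).tsum_add (hs _ _)]
    refine tsum_congr fun k => ?_
    have : f.coeff = (f - f₀).coeff + f₀.coeff := by
      rw [← ExpType.coeff_add, sub_add_cancel]
    rw [this, seqDelta_iterate_add, Pi.add_apply]
    ring
  rw [h1, h2]
  ring

theorem exists_opMap (hθ : 0 ≤ θ) (hω : 0 ≤ ω) (ha : 0 ≤ a) (hb : 0 ≤ b)
    (hab : b * expQuot a ω < 1) :
    ∃ T : ExpType a × ExpType b → ExpType (outType a ω b),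
      (∀ (φ : ExpType a) (f : ExpType b) (z : ℂ), HasSum (opTerm θ ω φ f z) (T (φ, f) z)) ∧
      (∀ φ f, (T (φ, f)).coeff = opCoeff θ ω φ.coeff f.coeff) ∧ Continuous T := by
  have hex : ∀ (q : ExpType a × ExpType b) (z : ℂ), ∃ y, HasSum (opTerm θ ω q.1 q.2 z) y ∧
      HasSum (fun n : ℕ => opCoeff θ ω q.1.coeff q.2.coeff n * (z ^ n / (n.factorial : ℂ))) y := by
    intro q z
    obtain ⟨a', b', -, -, hab', -⟩ := exists_opCoeff_bound hθ hω ha hb hab (lt_add_one _)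
    exact exists_hasSum_opTerm hθ hω a'.2.1.le b'.2.1.le hab' q.2.2.1 (q.1.norm_coeff_le a')
      (q.2.norm_coeff_le b') z
  choose g hg1 hg2 using hex
  have hg : ∀ q, Differentiable ℂ (g q) ∧
      ∀ n, iteratedDeriv n (g q) 0 = opCoeff θ ω q.1.coeff q.2.coeff n := fun q =>
    entire_of_hasSum (hg2 q)
  have hmem : ∀ q, g q ∈ expTypeSubmodule (outType a ω b) := by
    refine fun q => ⟨(hg q).1, fun c hc0 hc => ?_⟩
    obtain ⟨a', b', K, hK, -, hbd⟩ := exists_opCoeff_bound hθ hω ha hb hab hc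
    refine ⟨K * expSeminorm a a' q.1 * expSeminorm b b' q.2, ?_⟩
    rintro _ ⟨k, rfl⟩
    simp only [(hg q).2]
    rw [inv_mul_le_iff₀ (by positivity), mul_comm (c ^ k)]
    exact hbd q.1 q.2 k
  refine ⟨fun q => ⟨g q, hmem q⟩, fun φ f z => hg1 (φ, f) z, fun φ f => funext (hg (φ, f)).2, ?_⟩
  set T : ExpType a × ExpType b → ExpType (outType a ω b) := fun q => ⟨g q, hmem q⟩ with hT
  have hTc : ∀ q, (T q).coeff = opCoeff θ ω q.1.coeff q.2.coeff := fun q => funext (hg q).2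
  refine continuous_iff_continuousAt.2 fun q₀ => ?_
  refine ((expType_withSeminorms _).tendsto_nhds T (T q₀)).2 fun c ε hε => ?_
  obtain ⟨a', b', K, hK, -, hbd⟩ := exists_opCoeff_bound hθ hω ha hb hab c.2.2
  have := (expType_withSeminorms a).topologicalAddGroup
  have := (expType_withSeminorms b).topologicalAddGroup
  have hca := (expType_withSeminorms a).continuous_seminorm a'
  have hcb := (expType_withSeminorms b).continuous_seminorm b'
  -- This function dominates the seminorm of `T q - T q₀`; it is continuous and vanishes at q₀.
  have hcont : Continuous fun q : ExpType a × ExpType b =>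
      K * expSeminorm a a' (q.1 - q₀.1) * expSeminorm b b' q.2 +
        K * expSeminorm a a' q₀.1 * expSeminorm b b' (q.2 - q₀.2) := by
    have h1 := hca.comp (continuous_fst.sub (continuous_const (y := q₀.1)) :
      Continuous fun q : ExpType a × ExpType b => q.1 - q₀.1)
    have h2 := hcb.comp (continuous_snd.sub (continuous_const (y := q₀.2)) :
      Continuous fun q : ExpType a × ExpType b => q.2 - q₀.2)
    have h3 := hcb.comp (continuous_snd : Continuous fun q : ExpType a × ExpType b => q.2)
    exact ((continuous_const.mul h1).mul h3).add (continuous_const.mul h2)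
  have hev := hcont.continuousAt.eventually_lt (continuousAt_const (y := ε)) (x₀ := q₀)
    (by simpa using hε)
  filter_upwards [hev] with q hq
  refine lt_of_le_of_lt (ciSup_le fun k => ?_) hq
  have hc0 : (0 : ℝ) < c := c.2.1
  rw [inv_mul_le_iff₀ (by positivity), mul_comm ((c : ℝ) ^ k)]
  have hcoef : iteratedDeriv k (T q - T q₀) 0 =
      opCoeff θ ω (q.1 - q₀.1).coeff q.2.coeff k +
        opCoeff θ ω q₀.1.coeff (q.2 - q₀.2).coeff k := by
    rw [← opCoeff_sub_sub hθ hω ha hb hab, ← hTc, ← hTc, eq_sub_iff_add_eq]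
    have h := congrFun (ExpType.coeff_add (T q - T q₀) (T q₀)) k
    rw [sub_add_cancel] at h
    exact h.symm
  rw [hcoef, add_mul]
  exact (norm_add_le _ _).trans (add_le_add (hbd _ _ k) (hbd _ _ k))

end Operator

/-! ### Approximation of Laguerre entire functions from below -/

section Approximation

/-- The coefficients of `P` are nonnegative and bounded by those of `Q`. -/
def CoeffLE (P Q : ℝ[X]) : Prop := ∀ k, 0 ≤ P.coeff k ∧ P.coeff k ≤ Q.coeff k

theorem CoeffLE.mul {P Q P' Q' : ℝ[X]} (h : CoeffLE P Q) (h' : CoeffLE P' Q') :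
    CoeffLE (P * P') (Q * Q') := by
  intro k
  simp only [coeff_mul]
  exact ⟨Finset.sum_nonneg fun i _ => mul_nonneg (h _).1 (h' _).1, Finset.sum_le_sum fun i _ =>
    mul_le_mul (h _).2 (h' _).2 (h' _).1 ((h _).1.trans (h _).2)⟩

theorem coeffLE_one : CoeffLE 1 1 := by
  intro k
  rw [coeff_one]
  split_ifs <;> simp

theorem CoeffLE.pow {P Q : ℝ[X]} (h : CoeffLE P Q) (n : ℕ) : CoeffLE (P ^ n) (Q ^ n) := by
  induction n with
  | zero => simpa using coeffLE_one
  | succ n ih => simpa only [pow_succ] using ih.mul h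

theorem coeffLE_X : CoeffLE X X := by
  intro k
  rw [coeff_X]
  split_ifs <;> simp

theorem coeffLE_one_add {x : ℝ} (hx : 0 ≤ x) : CoeffLE 1 (1 + C x * X) := by
  intro k
  simp only [coeff_one, coeff_add, coeff_C_mul, coeff_X]
  split_ifs <;> simp_all

theorem coeffLE_one_add_self {x : ℝ} (hx : 0 ≤ x) : CoeffLE (1 + C x * X) (1 + C x * X) := by
  intro k
  simp only [coeff_one, coeff_add, coeff_C_mul, coeff_X]
  split_ifs <;> simp_all

theorem coeffLE_one_add_sq {x : ℝ} (hx : 0 ≤ x) :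
    CoeffLE (1 + C (2 * x) * X) ((1 + C x * X) ^ 2) := by
  have e : (1 + C x * X) ^ 2 = (1 + C (2 * x) * X : ℝ[X]) + C (x ^ 2) * X ^ 2 := by
    simp only [C_mul, C_pow, map_ofNat]
    ring
  intro k
  rw [e, coeff_add _ (C (x ^ 2) * X ^ 2)]
  refine ⟨(coeffLE_one_add_self (by positivity) k).1, le_add_of_nonneg_right ?_⟩
  rw [coeff_C_mul, coeff_X_pow]
  split_ifs <;> simp [sq_nonneg]

/-- Polynomials approximating `z^m e^{α z} ∏_j (1 + β_j z)`. -/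
def approxPoly (m : ℕ) (α : ℝ) (β : ℕ → ℝ) (n : ℕ) : ℝ[X] :=
  X ^ m * (1 + C (α / 2 ^ n) * X) ^ 2 ^ n * ∏ j ∈ Finset.range n, (1 + C (β j) * X)

variable {m : ℕ} {α : ℝ} {β : ℕ → ℝ}

/-- The exponents 2^n make consecutive approximants of e^{αz} comparable: with x = α/2^(n+1), raise
1 + 2xX ≤ (1 + xX)² to the power 2^n, coefficientwise. -/
theorem coeffLE_approxPoly_succ (hα : 0 ≤ α) (hβ : ∀ j, 0 ≤ β j) (n : ℕ) :
    CoeffLE (approxPoly m α β n) (approxPoly m α β (n + 1)) := by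
  refine ((coeffLE_X.pow m).mul ?_).mul ?_
  · have h := (coeffLE_one_add_sq (x := α / 2 ^ (n + 1)) (by positivity)).pow (2 ^ n)
    rw [← pow_mul, ← pow_succ'] at h
    convert h using 5
    rw [pow_succ]
    field_simp
  · rw [Finset.prod_range_succ]
    have h : CoeffLE (∏ j ∈ Finset.range n, (1 + C (β j) * X))
        (∏ j ∈ Finset.range n, (1 + C (β j) * X)) :=
      Finset.prod_induction _ (fun P => CoeffLE P P) (fun _ _ => CoeffLE.mul) coeffLE_one
        fun j _ => coeffLE_one_add_self (hβ j)
    simpa using h.mul (coeffLE_one_add (hβ n))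

theorem nonposRooted_approxPoly (hα : 0 ≤ α) (hβ : ∀ j, 0 ≤ β j) (n : ℕ) :
    NonposRooted ((approxPoly m α β n).map Complex.ofRealHom) := by
  simp only [approxPoly, Polynomial.map_mul, Polynomial.map_pow, Polynomial.map_add,
    Polynomial.map_one, Polynomial.map_X, Polynomial.map_C, Polynomial.map_prod,
    Complex.ofRealHom_eq_coe]
  exact ((nonposRooted_X.pow m).mul ((nonposRooted_one_add_C_mul_X (by positivity)).pow _)).mul
    (NonposRooted.prod fun j _ => nonposRooted_one_add_C_mul_X (hβ j))

theorem tendsto_eval_approxPoly (hβ : Summable β) (z : ℂ) :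
    Tendsto (fun n => ((approxPoly m α β n).map Complex.ofRealHom).eval z) atTop
      (𝓝 (z ^ m * Complex.exp (α * z) * ∏' j, (1 + (β j : ℂ) * z))) := by
  have h1 : Tendsto (fun n : ℕ => (1 + (α / 2 ^ n : ℂ) * z) ^ 2 ^ n) atTop
      (𝓝 (Complex.exp (α * z))) := by
    refine ((Complex.tendsto_one_add_div_pow_exp (α * z)).comp
      (tendsto_pow_atTop_atTop_of_one_lt one_lt_two)).congr fun n => ?_
    simp only [Function.comp_apply, Nat.cast_pow, Nat.cast_ofNat]
    ring_nf
  have h2 := (multipliable_one_add_of_summable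
    (summable_norm_ofReal_mul hβ z)).hasProd.tendsto_prod_nat
  refine ((tendsto_const_nhds.mul h1).mul h2).congr fun n => ?_
  simp [approxPoly, eval_prod, Polynomial.map_prod]

/-- If polynomials with nonnegative coefficients increasing with `n` converge pointwise, then so do
their coefficients, and the limits are the power series coefficients of the limit. -/
theorem exists_hasSum_of_coeffLE {P : ℕ → ℝ[X]} {h : ℂ → ℂ} (hP : ∀ n, CoeffLE (P n) (P (n + 1)))
    (hlim : ∀ z : ℂ, Tendsto (fun n => ((P n).map Complex.ofRealHom).eval z) atTop (𝓝 (h z))) :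
    ∃ c : ℕ → ℝ, (∀ n k, (P n).coeff k ≤ c k) ∧
      (∀ k, Tendsto (fun n => (P n).coeff k) atTop (𝓝 (c k))) ∧
      ∀ z : ℂ, HasSum (fun k => (c k : ℂ) * z ^ k) (h z) := by
  have hmono : ∀ k, Monotone fun n => (P n).coeff k := fun k =>
    monotone_nat_of_le_succ fun n => (hP n k).2
  -- With nonnegative coefficients each term at R is at most the value at R, and these values
  -- converge, hence are bounded.
  have hbd : ∀ R : ℝ, 0 ≤ R → ∃ S, ∀ n k, (P n).coeff k * R ^ k ≤ S := by
    intro R hR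
    obtain ⟨S, hS⟩ := (hlim R).norm.bddAbove_range
    refine ⟨S, fun n k => le_trans ?_ (hS ⟨n, rfl⟩)⟩
    have e : ((P n).map Complex.ofRealHom).eval (R : ℂ) = (((P n).eval R : ℝ) : ℂ) :=
      eval_map_apply Complex.ofRealHom R
    have hnn : ∀ i, 0 ≤ (P n).coeff i * R ^ i := fun i => mul_nonneg (hP n i).1 (by positivity)
    simp only [e, Complex.norm_real]
    refine le_trans ?_ (le_abs_self _)
    rw [eval_eq_sum_range]
    by_cases hk : k ∈ Finset.range ((P n).natDegree + 1)
    · exact Finset.single_le_sum (f := fun i => (P n).coeff i * R ^ i) (fun i _ => hnn i) hk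
    · rw [coeff_eq_zero_of_natDegree_lt (by simpa using hk), zero_mul]
      exact Finset.sum_nonneg fun i _ => hnn i
  have hbdd : ∀ k, BddAbove (Set.range fun n => (P n).coeff k) := by
    intro k
    obtain ⟨S, hS⟩ := hbd 1 zero_le_one
    refine ⟨S, ?_⟩
    rintro _ ⟨n, rfl⟩
    simpa using hS n k
  have hc := fun k => tendsto_atTop_ciSup (hmono k) (hbdd k)
  set c : ℕ → ℝ := fun k => ⨆ n, (P n).coeff k
  have hle : ∀ n k, (P n).coeff k ≤ c k := fun n k => le_ciSup (hbdd k) n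
  have hc0 : ∀ k, 0 ≤ c k := fun k => (hP 0 k).1.trans (hle 0 k)
  refine ⟨c, hle, hc, fun z => ?_⟩
  have hsum : Summable fun k => c k * ‖z‖ ^ k := by
    -- A bound at a radius of at least 2|z| gives decay with ratio 1/2 at |z|.
    obtain ⟨S, hS⟩ := hbd (2 * ‖z‖ + 1) (by positivity)
    have hcS : ∀ k, c k * (2 * ‖z‖ + 1) ^ k ≤ S := fun k =>
      le_of_tendsto' ((hc k).mul_const _) fun n => hS n k
    refine Summable.of_nonneg_of_le (fun k => mul_nonneg (hc0 k) (by positivity)) (fun k => ?_)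
      ((summable_geometric_of_lt_one (r := 1 / 2) (by norm_num) (by norm_num)).mul_left S)
    calc c k * ‖z‖ ^ k ≤ c k * ((2 * ‖z‖ + 1) * (1 / 2)) ^ k := by
          have := hc0 k
          gcongr
          linarith
      _ = c k * (2 * ‖z‖ + 1) ^ k * (1 / 2) ^ k := by rw [mul_pow]; ring
      _ ≤ S * (1 / 2) ^ k := by gcongr; exact hcS k
  have hcz : Summable fun k => (c k : ℂ) * z ^ k := by
    refine Summable.of_norm_bounded hsum fun k => ?_
    rw [norm_mul, norm_pow, Complex.norm_real, Real.norm_of_nonneg (hc0 k)]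
  have hT : Tendsto (fun n => ∑' k, ((P n).coeff k : ℂ) * z ^ k) atTop
      (𝓝 (∑' k, (c k : ℂ) * z ^ k)) := by
    refine tendsto_tsum_of_dominated_convergence hsum (fun k => ?_)
      (Eventually.of_forall fun n k => ?_)
    · exact ((Complex.continuous_ofReal.tendsto _).comp (hc k)).mul_const _
    · rw [norm_mul, norm_pow, Complex.norm_real, Real.norm_of_nonneg (hP n k).1]
      exact mul_le_mul_of_nonneg_right (hle n k) (by positivity)
  have heq : ∀ n, ∑' k, ((P n).coeff k : ℂ) * z ^ k = ((P n).map Complex.ofRealHom).eval z := by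
    intro n
    rw [eval_eq_sum_range, tsum_eq_sum (s := Finset.range
      (((P n).map Complex.ofRealHom).natDegree + 1))]
    · simp
    · intro k hk
      have : ((P n).map Complex.ofRealHom).coeff k = 0 :=
        coeff_eq_zero_of_natDegree_lt (by simpa using hk)
      rw [coeff_map, Complex.ofRealHom_eq_coe] at this
      rw [this, zero_mul]
  simp only [heq] at hT
  rw [tendsto_nhds_unique (hlim z) hT]
  exact hcz.hasSum

/-- A Laguerre entire function is, up to a constant, a limit of polynomials with roots in `(-∞, 0]`
whose coefficients are nonnegative and bounded by those of the limit. -/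
theorem IsLaguerreEntire.exists_approx {f : ℂ → ℂ} (hf : IsLaguerreEntire f) :
    ∃ (γ : ℂ) (P : ℕ → ℝ[X]), (∀ k, iteratedDeriv k f 0 = γ * ‖iteratedDeriv k f 0‖) ∧
      (∀ n, NonposRooted ((P n).map Complex.ofRealHom)) ∧
      (∀ n k, 0 ≤ (k.factorial : ℝ) * (P n).coeff k) ∧
      (∀ n k, (k.factorial : ℝ) * (P n).coeff k ≤ ‖iteratedDeriv k f 0‖) ∧
      ∀ k, Tendsto (fun n => (k.factorial : ℝ) * (P n).coeff k) atTop
        (𝓝 ‖iteratedDeriv k f 0‖) := by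
  obtain ⟨K, m, α, β, hα, -, hβ, hβs, hfz⟩ := hf
  have hP := coeffLE_approxPoly_succ (m := m) hα hβ
  obtain ⟨c, hle, hc, hsum⟩ := exists_hasSum_of_coeffLE hP
    (tendsto_eval_approxPoly (m := m) (α := α) hβs)
  have hc0 : ∀ k, 0 ≤ c k := fun k => (hP 0 k).1.trans (hle 0 k)
  have hder : ∀ k, iteratedDeriv k f 0 = K * ((k.factorial : ℝ) * c k : ℝ) := by
    refine (entire_of_hasSum fun z => ?_).2
    have h := (hsum z).mul_left K
    rw [← mul_assoc, ← mul_assoc, ← hfz] at h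
    refine h.congr_fun fun k => ?_
    have : (k.factorial : ℂ) ≠ 0 := by exact_mod_cast k.factorial_ne_zero
    push_cast
    field_simp
  have hnorm : ∀ k, ‖iteratedDeriv k f 0‖ = ‖K‖ * ((k.factorial : ℝ) * c k) := fun k => by
    have := hc0 k
    rw [hder, norm_mul, Complex.norm_real, Real.norm_of_nonneg (by positivity)]
  -- The phase of K goes into γ and its modulus into the polynomials. For K = 0 the quotient is 0,
  -- which is harmless since all derivatives vanish.
  refine ⟨K / ‖K‖, fun n => C ‖K‖ * approxPoly m α β n, fun k => ?_, fun n => ?_, fun n k => ?_,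
    fun n k => ?_, fun k => ?_⟩
  · rw [hnorm, hder]
    by_cases hK : K = 0
    · simp [hK]
    · have : (‖K‖ : ℂ) ≠ 0 := by exact_mod_cast norm_ne_zero_iff.2 hK
      push_cast
      field_simp
  · rw [Polynomial.map_mul, Polynomial.map_C, ← smul_eq_C_mul]
    exact (nonposRooted_approxPoly hα hβ n).smul _
  · rw [coeff_C_mul]
    have := (hP n k).1
    positivity
  · rw [hnorm, coeff_C_mul, mul_left_comm]
    have := hle n k
    gcongr
  · simp only [hnorm, coeff_C_mul, mul_left_comm _ ‖K‖]
    exact ((hc k).const_mul _).const_mul _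

end Approximation

/-! ### φ(Δ) on polynomials in terms of derivatives at 0 -/

section PolynomialOperator

/-- The derivatives at `0` of a polynomial. -/
def polySeq (p : ℂ[X]) (n : ℕ) : ℂ := (n.factorial : ℂ) * p.coeff n

theorem polySeq_polyDelta (θ ω : ℝ) (p : ℂ[X]) :
    polySeq (polyDelta θ ω p) = seqDelta θ ω (polySeq p) := by
  funext n
  rcases n with _ | n
  · simp [polySeq, seqDelta, polyDelta, coeff_derivative]
  · simp only [polySeq, seqDelta, polyDelta, LinearMap.add_apply, LinearMap.smul_apply,
      LinearMap.comp_apply, LinearMap.mulLeft_apply, coeff_add, coeff_smul, coeff_X_mul,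
      coeff_derivative, smul_eq_mul, Complex.real_smul, Nat.factorial_succ]
    push_cast
    ring

theorem polySeq_polyDelta_pow (θ ω : ℝ) (p : ℂ[X]) (k : ℕ) :
    polySeq ((polyDelta θ ω ^ k) p) = (seqDelta θ ω)^[k] (polySeq p) := by
  induction k with
  | zero => rfl
  | succ k ih =>
    rw [pow_succ', Module.End.mul_apply, polySeq_polyDelta, ih, Function.iterate_succ_apply']

/-- For a polynomial φ the series is finite; this joins the algebraic φ(Δ), for which the roots are
controlled, to the analytic one. -/
theorem polySeq_aeval_polyDelta (θ ω : ℝ) (φ p : ℂ[X]) :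
    polySeq (aeval (polyDelta θ ω) φ p) = opCoeff θ ω (polySeq φ) (polySeq p) := by
  funext n
  rw [opCoeff, tsum_eq_sum (s := Finset.range (φ.natDegree + 1))]
  · rw [aeval_eq_sum_range, polySeq, LinearMap.sum_apply, finsetSum_coeff, Finset.mul_sum]
    refine Finset.sum_congr rfl fun k _ => ?_
    rw [← polySeq_polyDelta_pow, LinearMap.smul_apply, coeff_smul, smul_eq_mul, polySeq, polySeq,
      mul_div_cancel_left₀ _ (by exact_mod_cast k.factorial_ne_zero)]
    ring
  · intro k hk
    rw [polySeq, coeff_eq_zero_of_natDegree_lt (by simpa using hk)]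
    simp

theorem eval_eq_tsum_polySeq (p : ℂ[X]) (z : ℂ) :
    p.eval z = ∑' n : ℕ, polySeq p n * (z ^ n / (n.factorial : ℂ)) := by
  rw [eval_eq_sum_range, tsum_eq_sum (s := Finset.range (p.natDegree + 1))]
  · refine Finset.sum_congr rfl fun n _ => ?_
    have : (n.factorial : ℂ) ≠ 0 := by exact_mod_cast n.factorial_ne_zero
    rw [polySeq]
    field_simp
  · intro n hn
    rw [polySeq, coeff_eq_zero_of_natDegree_lt (by simpa using hn)]
    simp

/-- Pulling out the phases of φ and f leaves nonnegative data in the application, so that comparison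
and domination apply. -/
theorem opCoeff_ofReal_mul (θ ω : ℝ) (γ δ : ℂ) (A B : ℕ → ℝ) (n : ℕ) :
    opCoeff θ ω (fun k => γ * (A k : ℂ)) (fun k => δ * (B k : ℂ)) n =
      γ * δ * ((opCoeff θ ω A B n : ℝ) : ℂ) := by
  unfold opCoeff
  rw [Complex.ofReal_tsum, ← tsum_mul_left]
  refine tsum_congr fun k => ?_
  have h : (fun k => δ * (B k : ℂ)) = δ • fun k => (B k : ℂ) := rfl
  rw [h, seqDelta_iterate_smul, Pi.smul_apply, seqDelta_iterate_ofReal, smul_eq_mul]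
  push_cast
  ring

end PolynomialOperator

/-! ### Conclusion: φ(Δ)f is a Laguerre entire function -/

/-- If the derivatives at `0` of `φ` and `f` are approximated from below by those of polynomials with
roots in `(-∞, 0]`, then `φ(Δ_{θ,ω}) f` is a Laguerre entire function. -/
theorem isLaguerreEntire_opCoeff {θ ω a b M N : ℝ} (hθ : 0 ≤ θ) (hω : 0 ≤ ω) (ha : 0 ≤ a)
    (hb : 0 ≤ b) (hab : b * expQuot a ω < 1) {A B : ℕ → ℝ} (hA0 : 0 ≤ A) (hB0 : 0 ≤ B)
    (hA : ∀ k, A k ≤ M * a ^ k) (hB : ∀ k, B k ≤ N * b ^ k) {P Q : ℕ → ℝ[X]}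
    (hP : ∀ n, NonposRooted ((P n).map Complex.ofRealHom))
    (hQ : ∀ n, NonposRooted ((Q n).map Complex.ofRealHom))
    (hP0 : ∀ n k, 0 ≤ (k.factorial : ℝ) * (P n).coeff k)
    (hQ0 : ∀ n k, 0 ≤ (k.factorial : ℝ) * (Q n).coeff k)
    (hPA : ∀ n k, (k.factorial : ℝ) * (P n).coeff k ≤ A k)
    (hQB : ∀ n k, (k.factorial : ℝ) * (Q n).coeff k ≤ B k)
    (hPt : ∀ k, Tendsto (fun n => (k.factorial : ℝ) * (P n).coeff k) atTop (𝓝 (A k)))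
    (hQt : ∀ k, Tendsto (fun n => (k.factorial : ℝ) * (Q n).coeff k) atTop (𝓝 (B k))) :
    IsLaguerreEntire fun z =>
      ∑' n : ℕ, ((opCoeff θ ω A B n : ℝ) : ℂ) * (z ^ n / (n.factorial : ℂ)) := by
  have hnn := opCoeff_term_nonneg hθ hω hA0 hB0
  have hs := summable_opCoeff_real hθ hω ha hb hab hA0 hB0 hA hB
  set Ps : ℕ → ℕ → ℝ := fun i k => (k.factorial : ℝ) * (P i).coeff k with hPs
  set Qs : ℕ → ℕ → ℝ := fun i k => (k.factorial : ℝ) * (Q i).coeff k with hQs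
  have hop0 : ∀ i n, 0 ≤ opCoeff θ ω (Ps i) (Qs i) n := fun i n =>
    tsum_nonneg (opCoeff_term_nonneg hθ hω (hP0 i) (hQ0 i) n)
  have hterm : ∀ i n k, Ps i k / (k.factorial : ℝ) * (seqDelta θ ω)^[k] (Qs i) n ≤
      A k / (k.factorial : ℝ) * (seqDelta θ ω)^[k] B n := by
    intro i n k
    refine mul_le_mul ?_ ((seqDelta_mono hθ hω).iterate k (hQB i) n)
      (seqDelta_iterate_nonneg hθ hω (hQ0 i) k n) (div_nonneg (hA0 k) (by positivity))
    have := hPA i k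
    gcongr
  have hople : ∀ i n, opCoeff θ ω (Ps i) (Qs i) n ≤ opCoeff θ ω A B n := fun i n =>
    Summable.tsum_le_tsum (hterm i n) ((hs n).1.of_nonneg_of_le
      (opCoeff_term_nonneg hθ hω (hP0 i) (hQ0 i) n) (hterm i n)) (hs n).1
  -- The approximants lie below their limits, so the series for A, B is itself the dominating one.
  have hoplim : ∀ n, Tendsto (fun i => opCoeff θ ω (Ps i) (Qs i) n) atTop
      (𝓝 (opCoeff θ ω A B n)) := by
    intro n
    refine tendsto_tsum_of_dominated_convergence (hs n).1 (fun k => ?_)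
      (Eventually.of_forall fun i k => ?_)
    · exact ((hPt k).div_const _).mul (tendsto_seqDelta_iterate θ ω hQt k n)
    · rw [Real.norm_of_nonneg (opCoeff_term_nonneg hθ hω (hP0 i) (hQ0 i) n k)]
      exact hterm i n k
  have hsumz : ∀ z : ℂ, Summable fun n : ℕ =>
      opCoeff θ ω A B n * (‖z‖ ^ n / (n.factorial : ℝ)) := by
    intro z
    refine Summable.of_nonneg_of_le
      (fun n => mul_nonneg (tsum_nonneg (hnn n)) (by positivity))
      (fun n => mul_le_mul_of_nonneg_right (hs n).2 (by positivity))
      ((summable_geometric_div_factorial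
        (M * N * (1 - b * expQuot a ω) ^ (-θ)) (outType a ω b) ‖z‖).congr fun n => ?_)
    rw [flowCoeff]
    ring
  have hlim : ∀ z : ℂ, Tendsto (fun i => (aeval (polyDelta θ ω) ((P i).map Complex.ofRealHom)
      ((Q i).map Complex.ofRealHom)).eval z) atTop
      (𝓝 (∑' n : ℕ, ((opCoeff θ ω A B n : ℝ) : ℂ) * (z ^ n / (n.factorial : ℂ)))) := by
    intro z
    have heq : ∀ i, (aeval (polyDelta θ ω) ((P i).map Complex.ofRealHom)
        ((Q i).map Complex.ofRealHom)).eval z =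
        ∑' n : ℕ, ((opCoeff θ ω (Ps i) (Qs i) n : ℝ) : ℂ) * (z ^ n / (n.factorial : ℂ)) := by
      intro i
      rw [eval_eq_tsum_polySeq, polySeq_aeval_polyDelta]
      refine tsum_congr fun n => ?_
      have h1 : polySeq ((P i).map Complex.ofRealHom) = fun k => 1 * (Ps i k : ℂ) := by
        funext k; simp [polySeq, hPs]
      have h2 : polySeq ((Q i).map Complex.ofRealHom) = fun k => 1 * (Qs i k : ℂ) := by
        funext k; simp [polySeq, hQs]
      rw [h1, h2, opCoeff_ofReal_mul, one_mul, one_mul]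
    simp only [heq]
    refine tendsto_tsum_of_dominated_convergence (hsumz z) (fun n => ?_)
      (Eventually.of_forall fun i n => ?_)
    · exact ((Complex.continuous_ofReal.tendsto _).comp (hoplim n)).mul_const _
    · rw [norm_mul, norm_div, norm_pow, Complex.norm_natCast, Complex.norm_real,
        Real.norm_of_nonneg (hop0 i n)]
      exact mul_le_mul_of_nonneg_right (hople i n) (by positivity)
  -- The limit lemma needs a nonzero value at 1. If that value is 0, a sum of nonnegative terms
  -- vanishes, so all coefficients and the function itself are 0.
  by_cases h1 : ∑' n : ℕ, ((opCoeff θ ω A B n : ℝ) : ℂ) * ((1 : ℂ) ^ n / (n.factorial : ℂ)) = 0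
  · have hR : ∑' n : ℕ, opCoeff θ ω A B n * (‖(1 : ℂ)‖ ^ n / (n.factorial : ℝ)) = 0 := by
      rw [← Complex.ofReal_eq_zero, Complex.ofReal_tsum, ← h1]
      refine tsum_congr fun n => ?_
      simp
    have h0 : ∀ n, opCoeff θ ω A B n = 0 := by
      intro n
      have h := (hsumz 1).hasSum
      have hnn' : (0 : ℕ → ℝ) ≤ fun n => opCoeff θ ω A B n * (‖(1 : ℂ)‖ ^ n / (n.factorial : ℝ)) :=
        fun n => mul_nonneg (tsum_nonneg (hnn n)) (by positivity)
      rw [hR, hasSum_zero_iff_of_nonneg hnn'] at h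
      have hn := congrFun h n
      simpa [Nat.factorial_ne_zero] using hn
    simpa [h0] using isLaguerreEntire_zero
  · exact IsLaguerreEntire.of_tendsto (fun i => (hP i).aeval_polyDelta hθ hω (hQ i)) hlim h1

end

theorem theorem2p3 (θ ω a b : ℝ) (hθ : 0 ≤ θ) (hω : 0 ≤ ω) (ha : 0 ≤ a) (hb : 0 ≤ b)
    (hab : b * expQuot a ω < 1) :
    ∃ T : laguerrePlus a × laguerrePlus b → laguerrePlus (outType a ω b),
      (∀ (φ : laguerrePlus a) (f : laguerrePlus b) (z : ℂ),
        HasSum (opTerm θ ω (φ : ExpType a) (f : ExpType b) z)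
          ((T (φ, f) : ExpType (outType a ω b)) z)) ∧
      Continuous T := by
  obtain ⟨T, hT, hTc, hTcont⟩ := exists_opMap hθ hω ha hb hab
  have hmem : ∀ q : laguerrePlus a × laguerrePlus b,
      T (q.1, q.2) ∈ laguerrePlus (outType a ω b) := by
    rintro ⟨⟨φ, hφ⟩, ⟨f, hf⟩⟩
    obtain ⟨γ, P, hγ, hP, hP0, hPA, hPt⟩ := IsLaguerreEntire.exists_approx hφ
    obtain ⟨δ, Q, hδ, hQ, hQ0, hQB, hQt⟩ := IsLaguerreEntire.exists_approx hf
    obtain ⟨a', b', -, -, hab', -⟩ := exists_opCoeff_bound hθ hω ha hb hab (lt_add_one _)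
    -- The data here are the absolute values of the derivatives; the constant γδ restores the phases
    -- of φ and f.
    have h := (isLaguerreEntire_opCoeff hθ hω a'.2.1.le b'.2.1.le hab' (fun _ => norm_nonneg _)
      (fun _ => norm_nonneg _) (φ.norm_coeff_le a') (f.norm_coeff_le b') hP hQ hP0 hQ0 hPA hQB
      hPt hQt).const_mul (γ * δ)
    change IsLaguerreEntire (T (φ, f)).1
    convert h using 1
    funext z
    refine (hasSum_iteratedDeriv_of_entire (T (φ, f)).2.1 z).tsum_eq.symm.trans ?_
    rw [← tsum_mul_left]
    refine tsum_congr fun n => ?_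
    have e : iteratedDeriv n (T (φ, f)).1 0 = opCoeff θ ω φ.coeff f.coeff n :=
      congrFun (hTc φ f) n
    have e1 : φ.coeff = fun k => γ * ((‖φ.coeff k‖ : ℝ) : ℂ) := funext hγ
    have e2 : f.coeff = fun k => δ * ((‖f.coeff k‖ : ℝ) : ℂ) := funext hδ
    rw [e, e1, e2, opCoeff_ofReal_mul, ← e1, ← e2, mul_assoc]
  refine ⟨fun q => ⟨T (q.1, q.2), hmem q⟩, fun φ f z => hT φ f z, ?_⟩
  exact (hTcont.comp ((continuous_subtype_val.comp continuous_fst).prodMk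
    (continuous_subtype_val.comp continuous_snd))).subtype_mk _
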